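/- **Setting.** Cells are pairs $(x,y)$ of non-negative integers. A *shape* $S$ of order $n$ is a set of $n$ cells (the cells occupied by its nodes); two distinct nodes are neighbours if their cells are adjacent horizontally, vertically or diagonally, and $S$ is *connected* if the resulting graph on its nodes is connected (in particular $n\ge 1$). A *line move* takes a horizontal or vertical line of $k\ge1$ consecutive nodes and pushes all of them by one position along the axis of the line, provided that the cell in front of the line is empty. A transformation *preserves connectivity* if the shape is connected before the first and after every line move. A shape is *nice* if it contains a horizontal or vertical line $L$ such that every node of the shape reaches $L$ along a line of nodes perpendicular to $L$. A *compressed square* of a shape $S$ of order $n$ is a nice shape of order $n$ obtained as follows: enclose $S$ in an $n\times n$ box, divide the box into sub-boxes of size $\lceil\sqrt n\,\rceil\times\lceil\sqrt n\,\rceil$ (those on the border may stick out of the box); the nice shape lies in one of the sub-boxes. (If $n$ is a perfect square, it is a full sub-box.) **Theorem.** There is a constant $C$ such that for any two connected shapes $S_I,S_F$ of the same order $n$ there are a translate $S$ of $S_F$, namely $S=S_F$ itself if $S_I$ and $S_F$ lie in a common $n\times n$ box, and a connectivity-preserving sequence of at most $C\,n\sqrt n$ line moves that transforms $S_I$ into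 $S$. The sequence passes, in this order, through a compressed square of $S_I$, a straight line of order $n$, and a compressed square of $S$; the part from the first compressed square to the line and the part from the line to the second compressed square consist of at most $C\,n$ line moves each. In the same sense, $S$ is transformed into $S_I$ by a connectivity-preserving sequence of at most $C\,n\sqrt n$ line moves. -/

import Mathlib

/-- A cell of the grid: a pair (column, row) of non-negative integers. -/
abbrev Cell : Type := ℕ × ℕ

/-- A shape: the finite set of cells occupied by the nodes. Its order is its cardinality. -/
abbrev Shape : Type := Finset Cell

/-- Two cells are neighbours if they are adjacent vertically, horizontally or diagonally. -/
def Cell.Neighbour (u v : Cell) : Prop :=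
  u ≠ v ∧ v.1 ≤ u.1 + 1 ∧ u.1 ≤ v.1 + 1 ∧ v.2 ≤ u.2 + 1 ∧ u.2 ≤ v.2 + 1

/-- The graph associated with a shape. -/
def Shape.graph (S : Shape) : SimpleGraph {u : Cell // u ∈ S} where
  Adj u v := Cell.Neighbour u.1 v.1
  symm := ⟨fun _ _ h => ⟨h.1.symm, h.2.2.1, h.2.1, h.2.2.2.2, h.2.2.2.1⟩⟩
  loopless := ⟨fun _ h => h.1 rfl⟩

/-- A shape is connected if its associated graph is. In particular it is non-empty. -/
def Shape.IsConnected (S : Shape) : Prop := (Shape.graph S).Connected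

/-- The cells `(x, y), (x + 1, y), …, (x + k - 1, y)`. -/
def hLine (x y k : ℕ) : Shape := (Finset.range k).image fun i => (x + i, y)

/-- The cells `(x, y), (x, y + 1), …, (x, y + k - 1)`. -/
def vLine (x y k : ℕ) : Shape := (Finset.range k).image fun i => (x, y + i)

/-- `LineMove S S'`: the shape `S'` arises from `S` by one permissible line move, that is, a line
of `k ≥ 1` nodes of `S` is pushed by one position, along its own axis, into an empty cell. -/
inductive LineMove (S S' : Shape) : Prop
  | right (x y k : ℕ) (hk : 1 ≤ k) (hL : hLine x y k ⊆ S) (he : (x + k, y) ∉ S)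
      (h : S' = (S \ hLine x y k) ∪ hLine (x + 1) y k)
  | left (x y k : ℕ) (hk : 1 ≤ k) (hL : hLine (x + 1) y k ⊆ S) (he : (x, y) ∉ S)
      (h : S' = (S \ hLine (x + 1) y k) ∪ hLine x y k)
  | up (x y k : ℕ) (hk : 1 ≤ k) (hL : vLine x y k ⊆ S) (he : (x, y + k) ∉ S)
      (h : S' = (S \ vLine x y k) ∪ vLine x (y + 1) k)
  | down (x y k : ℕ) (hk : 1 ≤ k) (hL : vLine x (y + 1) k ⊆ S) (he : (x, y) ∉ S)
      (h : S' = (S \ vLine x (y + 1) k) ∪ vLine x y k)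

/-- The sequence `f 0, f 1, …, f t` transforms `S` into `S'` by `t` line moves, one per step,
and the shape is connected throughout. -/
def IsConnectedTransformation (f : ℕ → Shape) (t : ℕ) (S S' : Shape) : Prop :=
  f 0 = S ∧ f t = S' ∧ (∀ i < t, LineMove (f i) (f (i + 1))) ∧ ∀ i ≤ t, (f i).IsConnected

/-- The shape is a straight line, horizontal or vertical. -/
def Shape.IsStraightLine (S : Shape) : Prop :=
  ∃ x y k : ℕ, 1 ≤ k ∧ (S = hLine x y k ∨ S = vLine x y k)

/-- `c` lies between `a` and `b`, endpoints included. -/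
def Between (a c b : ℕ) : Prop := (a ≤ c ∧ c ≤ b) ∨ (b ≤ c ∧ c ≤ a)

/-- A nice shape: it contains a (central) line such that every node reaches that line along
a line of nodes perpendicular to it. -/
def Shape.IsNice (S : Shape) : Prop :=
  (∃ x y k : ℕ, 1 ≤ k ∧ hLine x y k ⊆ S ∧
    ∀ u ∈ S, (u.1, y) ∈ hLine x y k ∧ ∀ c, Between y c u.2 → (u.1, c) ∈ S) ∨
  (∃ x y k : ℕ, 1 ≤ k ∧ vLine x y k ⊆ S ∧
    ∀ u ∈ S, (x, u.2) ∈ vLine x y k ∧ ∀ c, Between x c u.1 → (c, u.2) ∈ S)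

/-- The square box of side `s` whose lower left cell is `(a, b)`. -/
def squareBox (a b s : ℕ) : Shape := Finset.Ico a (a + s) ×ˢ Finset.Ico b (b + s)

/-- The side `√n` of the sub-boxes, rounded up to an integer. -/
noncomputable def subSide (n : ℕ) : ℕ := ⌈√(n : ℝ)⌉₊

/-- `Q` is a compressed square obtained from `S`, a shape of order `n`: enclose `S` in an `n × n`
box and divide it into sub-boxes of side `√n`; then `Q` is a nice shape of order `n`
that lies in one of the sub-boxes. (If `n` is a perfect square, `Q` is a full sub-box.) -/
def IsCompressedSquare (S Q : Shape) : Prop :=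
  Q.card = S.card ∧ Q.IsNice ∧ ∃ a b i j : ℕ,
    S ⊆ squareBox a b S.card ∧ i < subSide S.card ∧ j < subSide S.card ∧
    Q ⊆ squareBox (a + i * subSide S.card) (b + j * subSide S.card) (subSide S.card)

/-- `UCBoxTransforms C t S S'`: a sequence of `t` connectivity-preserving line moves takes `S`
to a compressed square of `S`, from there to a straight line, from there to a compressed
square of `S'`, and from there to `S'`. Each of the two passages between a compressed square
and the line takes at most `C * n` moves, where `n` is the order of `S`. -/
def UCBoxTransforms (C : ℝ) (t : ℕ) (S S' : Shape) : Prop :=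
  ∃ (f : ℕ → Shape) (t₁ t₂ t₃ : ℕ),
    IsConnectedTransformation f t S S' ∧ t₁ ≤ t₂ ∧ t₂ ≤ t₃ ∧ t₃ ≤ t ∧
    IsCompressedSquare S (f t₁) ∧ (f t₂).IsStraightLine ∧ IsCompressedSquare S' (f t₃) ∧
    ((t₂ - t₁ : ℕ) : ℝ) ≤ C * S.card ∧ ((t₃ - t₂ : ℕ) : ℝ) ≤ C * S.card

/-- `S'` is a translate of `S` (both lie in the non-negative quadrant). -/
def IsTranslate (S S' : Shape) : Prop :=
  ∃ a b : Cell, S.image (fun u => u + a) = S'.image (fun u => u + b)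

/-!
A line move is determined by what it does to the set of occupied cells: the cell at the rear of
the line is vacated and the empty cell in front of the line is occupied (`Mv`). So in one move a
cell may jump along a straight run of occupied cells, whatever the length of the run. The argument
is carried out on `ℤ × ℤ`, with all shapes contained in the quadrant, because there it may be
rotated freely (`frame`). Since moves are reversible, it is enough to transform every connected
shape `S` of order `n` in an `n × n` box into one line that depends only on the box by `O(n √n)`
moves, and to transform this line into a nice shape in a sub-box by `O(n)` moves.

The plane is cut into boxes of side about `√n`, and `S` is assembled from connected pieces, each
in a single box, attached one after the other (`Built`). A new piece is needed only
for a cell that has a neighbour in another box. Averaging over the offset of the boxes shows that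
`O(√n)` pieces suffice for some offset (`exists_offset`, `exists_built`).

The last piece `A` touches the rest `R` of the shape, which is connected, at some cell `c`. In
`O(n)` moves it is dissolved into `R` (`Built.reduce`). First, `A` is gathered around the axis
through `c` that points out of the box: cells drop towards the axis, those farthest from it
first, which keeps `A` connected (`exists_drop`, `exists_comb`). If `A` comes near another cell of
the shape in its own box on the way, it joins the piece of that cell, and nothing remains to
be done. Otherwise `A` becomes a comb whose spine on the axis ends at `c`. Its cells are then
pushed through `c` into the next box at three moves per cell (`IsFeeder.push`,
`IsFeeder.transfer`): a push along the axis moves the first cell of the spine to the first hole of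
the axis in the next box; if there is none, a hole is made by pushing a cell of the axis sideways
within that box, which has room for all `n` cells. A column of the comb closes the gap in the
spine. If `A` touches `R` only diagonally across a corner of the boxes, two such crossings lead
around the corner.

After `O(√n)` rounds the shape lies in one box (`Built.collapse`). The same crossing, with
nothing on the other side, then pulls it out into a straight line (`exists_tr_line`), which is slid
and turned into the prescribed position; the turn is again a crossing. All this costs `O(n)`.
In particular it applies to the square that is filled column by column (`fillSquare`), and so
links this compressed square to the line by `O(n)` moves (`tr_fillSquare`).
-/

/-! ### Connected finite sets of cells of `ℤ × ℤ` -/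

/-- A cell of the full integer grid. -/
abbrev Pt : Type := ℤ × ℤ

/-- Two cells are near if they are equal, or adjacent horizontally, vertically or diagonally. -/
def Near (u v : Pt) : Prop :=
  u.1 ≤ v.1 + 1 ∧ v.1 ≤ u.1 + 1 ∧ u.2 ≤ v.2 + 1 ∧ v.2 ≤ u.2 + 1

/-- `u` and `v` are joined by a path of pairwise near cells of `T`. -/
def Link (T : Finset Pt) : Pt → Pt → Prop :=
  Relation.ReflTransGen fun a b => a ∈ T ∧ b ∈ T ∧ Near a b

/-- A non-empty finite set of cells any two of which are joined by a path inside the set. -/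
def Conn (T : Finset Pt) : Prop :=
  T.Nonempty ∧ ∀ u ∈ T, ∀ v ∈ T, Link T u v

theorem Near.symm {u v : Pt} (h : Near u v) : Near v u := ⟨h.2.1, h.1, h.2.2.2, h.2.2.1⟩

theorem Near.refl (u : Pt) : Near u u := by unfold Near; omega

theorem Link.symm {T : Finset Pt} {u v : Pt} (h : Link T u v) : Link T v u := by
  induction h with
  | refl => exact Relation.ReflTransGen.refl
  | tail _ h ih => exact Relation.ReflTransGen.head ⟨h.2.1, h.1, h.2.2.symm⟩ ih

theorem Link.trans {T : Finset Pt} {u v w : Pt} (h : Link T u v) (h' : Link T v w) : Link T u w :=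
  Relation.ReflTransGen.trans h h'

theorem Link.mono {T T' : Finset Pt} (hT : T ⊆ T') {u v : Pt} (h : Link T u v) : Link T' u v := by
  induction h with
  | refl => exact Relation.ReflTransGen.refl
  | tail _ h ih => exact ih.tail ⟨hT h.1, hT h.2.1, h.2.2⟩

theorem Link.of_near {T : Finset Pt} {u v : Pt} (hu : u ∈ T) (hv : v ∈ T) (h : Near u v) :
    Link T u v :=
  Relation.ReflTransGen.single ⟨hu, hv, h⟩

theorem Conn.of_center {T : Finset Pt} {w : Pt} (hw : w ∈ T) (h : ∀ u ∈ T, Link T w u) :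
    Conn T :=
  ⟨⟨w, hw⟩, fun u hu v hv => (h u hu).symm.trans (h v hv)⟩

theorem Conn.singleton (u : Pt) : Conn {u} :=
  Conn.of_center (Finset.mem_singleton_self u) fun v hv => by
    rw [Finset.mem_singleton.1 hv]; exact Relation.ReflTransGen.refl

theorem Conn.union_of_near {X Y : Finset Pt} (hX : Conn X) (hY : Conn Y) {x y : Pt} (hx : x ∈ X)
    (hy : y ∈ Y) (h : Near x y) : Conn (X ∪ Y) := by
  refine Conn.of_center (Finset.mem_union_left _ hx) fun u hu => ?_
  rcases Finset.mem_union.1 hu with hu | hu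
  · exact (hX.2 x hx u hu).mono Finset.subset_union_left
  · exact (Link.of_near (Finset.mem_union_left _ hx) (Finset.mem_union_right _ hy) h).trans
      ((hY.2 y hy u hu).mono Finset.subset_union_right)

theorem Conn.insert_of_near {X : Finset Pt} (hX : Conn X) {x z : Pt} (hx : x ∈ X) (h : Near x z) :
    Conn (insert z X) := by
  have := hX.union_of_near (Conn.singleton z) hx (Finset.mem_singleton_self z) h
  rwa [Finset.union_comm] at this

/-- Removing `u` and adding `v` keeps a set connected if `v` and all neighbours of `u` are joined
to one and the same cell `w` in the new set. -/
theorem Conn.replace {T : Finset Pt} (hT : Conn T) {u v w : Pt} (hu : u ∈ T)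
    (hw : w ∈ insert v (T.erase u)) (hv : Link (insert v (T.erase u)) w v)
    (hz : ∀ z ∈ T, z ≠ u → Near u z → Link (insert v (T.erase u)) w z) :
    Conn (insert v (T.erase u)) := by
  have key : ∀ z, Link T u z → z = u ∨ Link (insert v (T.erase u)) w z := by
    intro z h
    induction h with
    | refl => exact Or.inl rfl
    | @tail b c _ hbc ih =>
      by_cases hc : c = u
      · exact Or.inl hc
      right
      rcases ih with rfl | ih
      · exact hz c hbc.2.1 hc hbc.2.2
      · by_cases hb : b = u
        · subst hb; exact hz c hbc.2.1 hc hbc.2.2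
        · exact ih.trans (Link.of_near (Finset.mem_insert_of_mem (Finset.mem_erase.2 ⟨hb, hbc.1⟩))
            (Finset.mem_insert_of_mem (Finset.mem_erase.2 ⟨hc, hbc.2.1⟩)) hbc.2.2)
  refine Conn.of_center hw fun z hz' => ?_
  rcases Finset.mem_insert.1 hz' with rfl | hz'
  · exact hv
  · have := Finset.mem_erase.1 hz'
    exact (key z (hT.2 u hu z this.2)).resolve_left this.1

theorem link_col_of_le {T : Finset Pt} {x y y' : ℤ} (hy : y ≤ y')
    (h : ∀ i, y ≤ i → i ≤ y' → (x, i) ∈ T) : Link T (x, y) (x, y') := by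
  induction y', hy using Int.leInduction with
  | base => exact Relation.ReflTransGen.refl
  | succ k hk ih =>
    refine (ih fun i h1 h2 => h i h1 (by omega)).trans
      (Link.of_near (h k hk (by omega)) (h (k + 1) (by omega) le_rfl) ?_)
    simp only [Near]; omega

theorem link_row_of_le {T : Finset Pt} {x x' y : ℤ} (hx : x ≤ x')
    (h : ∀ i, x ≤ i → i ≤ x' → (i, y) ∈ T) : Link T (x, y) (x', y) := by
  induction x', hx using Int.leInduction with
  | base => exact Relation.ReflTransGen.refl
  | succ k hk ih =>
    refine (ih fun i h1 h2 => h i h1 (by omega)).trans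
      (Link.of_near (h k hk (by omega)) (h (k + 1) (by omega) le_rfl) ?_)
    simp only [Near]; omega

theorem link_col {T : Finset Pt} {x y y' : ℤ}
    (h : ∀ i, (y ≤ i ∧ i ≤ y') ∨ (y' ≤ i ∧ i ≤ y) → (x, i) ∈ T) : Link T (x, y) (x, y') := by
  rcases le_total y y' with hy | hy
  · exact link_col_of_le hy fun i h1 h2 => h i (Or.inl ⟨h1, h2⟩)
  · exact (link_col_of_le hy fun i h1 h2 => h i (Or.inr ⟨h1, h2⟩)).symm

/-- A connected set meets every column between two of its cells. -/
theorem Conn.exists_fst_eq {T : Finset Pt} (hT : Conn T) {u v : Pt} (hu : u ∈ T) (hv : v ∈ T)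
    {x : ℤ} (h1 : u.1 ≤ x) (h2 : x ≤ v.1) : ∃ w ∈ T, w.1 = x := by
  have key : ∀ z, Link T u z → x ≤ z.1 → ∃ w ∈ T, w.1 = x := by
    intro z h
    induction h with
    | refl => exact fun h => ⟨u, hu, by omega⟩
    | @tail b c _ hbc ih =>
      intro hc
      by_cases hb : x ≤ b.1
      · exact ih hb
      · exact ⟨c, hbc.2.1, by have := hbc.2.2; unfold Near at this; omega⟩
  exact key v (hT.2 u hu v hv) h2

/-- A connected set meets every row between two of its cells. -/
theorem Conn.exists_snd_eq {T : Finset Pt} (hT : Conn T) {u v : Pt} (hu : u ∈ T) (hv : v ∈ T)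
    {y : ℤ} (h1 : u.2 ≤ y) (h2 : y ≤ v.2) : ∃ w ∈ T, w.2 = y := by
  have key : ∀ z, Link T u z → y ≤ z.2 → ∃ w ∈ T, w.2 = y := by
    intro z h
    induction h with
    | refl => exact fun h => ⟨u, hu, by omega⟩
    | @tail b c _ hbc ih =>
      intro hc
      by_cases hb : y ≤ b.2
      · exact ih hb
      · exact ⟨c, hbc.2.1, by have := hbc.2.2; unfold Near at this; omega⟩
  exact key v (hT.2 u hu v hv) h2

/-! ### Line moves on the integer grid -/

/-- A line move, described by its effect on the set of occupied cells: pushing a line by one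
position vacates the cell at its rear and occupies the empty cell in front of it. The first
alternative is a horizontal move, the second one a vertical move. -/
def Mv (S S' : Finset Pt) : Prop :=
  (∃ x x' y : ℤ, x ≠ x' ∧ (∀ i, (x ≤ i ∧ i < x') ∨ (x' < i ∧ i ≤ x) → (i, y) ∈ S) ∧
    (x', y) ∉ S ∧ S' = insert (x', y) (S.erase (x, y))) ∨
  (∃ x y y' : ℤ, y ≠ y' ∧ (∀ i, (y ≤ i ∧ i < y') ∨ (y' < i ∧ i ≤ y) → (x, i) ∈ S) ∧
    (x, y') ∉ S ∧ S' = insert (x, y') (S.erase (x, y)))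

theorem insert_erase_insert_erase {S : Finset Pt} {p q : Pt} (hp : p ∈ S) (hq : q ∉ S) :
    S = insert p ((insert q (S.erase p)).erase q) := by
  ext z
  simp only [Finset.mem_insert, Finset.mem_erase]
  by_cases h1 : z = p
  · subst h1; simp [hp]
  · by_cases h2 : z = q
    · subst h2; simp [hq, h1]
    · simp [h1, h2]

theorem Mv.symm {S S' : Finset Pt} (h : Mv S S') : Mv S' S := by
  rcases h with ⟨x, x', y, hne, hr, hn, rfl⟩ | ⟨x, y, y', hne, hr, hn, rfl⟩
  · have hp : (x, y) ∈ S := hr x (by omega)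
    refine Or.inl ⟨x', x, y, hne.symm, fun i hi => ?_, ?_, insert_erase_insert_erase hp hn⟩
    · by_cases h : i = x'
      · subst h; simp
      · have := hr i (by omega)
        have h2 : i ≠ x := by omega
        simp [h, h2, this]
    · simp [hne]
  · have hp : (x, y) ∈ S := hr y (by omega)
    refine Or.inr ⟨x, y', y, hne.symm, fun i hi => ?_, ?_, insert_erase_insert_erase hp hn⟩
    · by_cases h : i = y'
      · subst h; simp
      · have := hr i (by omega)
        have h2 : i ≠ y := by omega
        simp [h, h2, this]
    · simp [hne]

theorem card_insert_erase {S : Finset Pt} {p q : Pt} (hp : p ∈ S) (hq : q ∉ S) :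
    (insert q (S.erase p)).card = S.card := by
  rw [Finset.card_insert_of_notMem fun h => hq (Finset.mem_of_mem_erase h),
    Finset.card_erase_of_mem hp]
  have := Finset.card_pos.2 ⟨p, hp⟩
  omega

theorem Mv.card_eq {S S' : Finset Pt} (h : Mv S S') : S'.card = S.card := by
  rcases h with ⟨x, x', y, hne, hr, hn, rfl⟩ | ⟨x, y, y', hne, hr, hn, rfl⟩
  · exact card_insert_erase (hr x (by omega)) hn
  · exact card_insert_erase (hr y (by omega)) hn

/-- `Tr W t S S'`: at most `t` line moves transform `S` into `S'`, and all shapes on the way,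
`S` and `S'` included, are connected and contained in `W`. -/
inductive Tr (W : Set Pt) : ℕ → Finset Pt → Finset Pt → Prop
  | refl (t : ℕ) {S : Finset Pt} (hc : Conn S) (hW : ∀ u ∈ S, u ∈ W) : Tr W t S S
  | tail {t : ℕ} {S S' S'' : Finset Pt} (h : Tr W t S S') (hm : Mv S' S'') (hc : Conn S'')
      (hW : ∀ u ∈ S'', u ∈ W) : Tr W (t + 1) S S''

namespace Tr

variable {W : Set Pt} {S S' S'' : Finset Pt} {t t' : ℕ}

theorem conn_right (h : Tr W t S S') : Conn S' := by
  cases h with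
  | refl _ hc _ => exact hc
  | tail _ _ hc _ => exact hc

theorem subset_right (h : Tr W t S S') : ∀ u ∈ S', u ∈ W := by
  cases h with
  | refl _ _ hW => exact hW
  | tail _ _ _ hW => exact hW

theorem card_eq (h : Tr W t S S') : S'.card = S.card := by
  induction h with
  | refl => rfl
  | tail _ hm _ _ ih => rw [hm.card_eq, ih]

theorem mono (h : Tr W t S S') (ht : t ≤ t') : Tr W t' S S' := by
  induction h generalizing t' with
  | refl _ hc hW => exact refl _ hc hW
  | tail _ hm hc hW ih =>
    obtain ⟨t'', rfl⟩ := Nat.exists_eq_add_of_le ht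
    rw [show ∀ a, a + 1 + t'' = a + t'' + 1 by intro a; omega]
    exact tail (ih (by omega)) hm hc hW

theorem trans (h : Tr W t S S') (h' : Tr W t' S' S'') : Tr W (t + t') S S'' := by
  induction h' with
  | refl _ _ _ => exact h.mono (by omega)
  | tail _ hm hc hW ih => exact tail (ih h) hm hc hW

theorem single (hc : Conn S) (hW : ∀ u ∈ S, u ∈ W) (hm : Mv S S') (hc' : Conn S')
    (hW' : ∀ u ∈ S', u ∈ W) : Tr W 1 S S' :=
  tail (refl 0 hc hW) hm hc' hW'

theorem symm (h : Tr W t S S') : Tr W t S' S := by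
  induction h with
  | refl _ hc hW => exact refl _ hc hW
  | tail h hm hc hW ih =>
    have := (single hc hW hm.symm h.conn_right h.subset_right).trans ih
    exact this.mono (by omega)

end Tr

/-! ### Gathering a connected set around a row -/

/-- `y'` lies between `0` and `y`. -/
def Toward (y y' : ℤ) : Prop := (0 ≤ y' ∧ y' ≤ y) ∨ (y ≤ y' ∧ y' ≤ 0)

/-- A set which contains, with each of its cells, the vertical segment from that cell to row `0`. -/
def IsComb (A : Finset Pt) : Prop := ∀ x y y', (x, y) ∈ A → Toward y y' → (x, y') ∈ A

/-- The vertical segment from `(x, y)` to row `0` is not contained in `A`. -/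
def HasGap (A : Finset Pt) (x y : ℤ) : Prop := ∃ y', Toward y y' ∧ (x, y') ∉ A

open Classical in
/-- The cells of `B`, outside row `0`, that lie on the segment to row `0` from a cell of `A` for
which this segment has a gap. -/
noncomputable def gapCells (B A : Finset Pt) : Finset Pt :=
  B.filter fun q => ∃ y, (q.1, y) ∈ A ∧ HasGap A q.1 y ∧ Toward y q.2 ∧ q.2 ≠ 0

/-- As long as `A` is not a comb, a cell of `A` can be dropped into the first gap on its way to
row `0` so that `A` stays connected. The cell is one of those with a gap which are farthest from
row `0`; this is what preserves connectivity and makes `gapCells` shrink. -/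
theorem exists_drop {A B : Finset Pt} (hAB : A ⊆ B) (hA : Conn A) (hnc : ¬ IsComb A) :
    ∃ x y y', y ≠ y' ∧ y ≠ 0 ∧ Toward y y' ∧ (x, y') ∉ A ∧
      (∀ i, (y ≤ i ∧ i < y') ∨ (y' < i ∧ i ≤ y) → (x, i) ∈ A) ∧
      Conn (insert (x, y') (A.erase (x, y))) ∧
      (gapCells B (insert (x, y') (A.erase (x, y)))).card < (gapCells B A).card := by
  classical
  obtain ⟨⟨x, y⟩, hu, hmax⟩ : ∃ u ∈ A.filter (fun u => HasGap A u.1 u.2),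
      ∀ z ∈ A.filter (fun u => HasGap A u.1 u.2), z.2.natAbs ≤ u.2.natAbs := by
    apply Finset.exists_max_image
    unfold IsComb at hnc
    push Not at hnc
    obtain ⟨x, y, y', h1, h2, h3⟩ := hnc
    exact ⟨(x, y), Finset.mem_filter.2 ⟨h1, y', h2, h3⟩⟩
  obtain ⟨huA, hgap⟩ := Finset.mem_filter.1 hu
  simp only at hgap
  have hmax' : ∀ a b, (a, b) ∈ A → HasGap A a b → b.natAbs ≤ y.natAbs := fun a b h1 h2 =>
    hmax (a, b) (Finset.mem_filter.2 ⟨h1, h2⟩)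
  obtain ⟨y', hy', hfirst⟩ : ∃ y' ∈ (Finset.Icc (-(y.natAbs : ℤ)) y.natAbs).filter
      (fun i => Toward y i ∧ (x, i) ∉ A),
      ∀ i ∈ (Finset.Icc (-(y.natAbs : ℤ)) y.natAbs).filter
      (fun i => Toward y i ∧ (x, i) ∉ A), i.natAbs ≤ y'.natAbs := by
    apply Finset.exists_max_image
    obtain ⟨i, h1, h2⟩ := hgap
    refine ⟨i, Finset.mem_filter.2 ⟨Finset.mem_Icc.2 ?_, h1, h2⟩⟩
    unfold Toward at h1; omega
  obtain ⟨-, hto, hvA⟩ := Finset.mem_filter.1 hy'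
  have hrun : ∀ i, Toward y i → y'.natAbs < i.natAbs → (x, i) ∈ A := by
    intro i h1 h2
    by_contra h3
    have := hfirst i (Finset.mem_filter.2 ⟨Finset.mem_Icc.2 (by unfold Toward at h1; omega), h1, h3⟩)
    omega
  have hne : y ≠ y' := by rintro rfl; exact hvA huA
  have hy0 : y ≠ 0 := by rintro rfl; apply hne; unfold Toward at hto; omega
  unfold Toward at hto hrun
  obtain ⟨s, hs⟩ : ∃ s : ℤ, (s = 1 ∧ 0 < y) ∨ (s = -1 ∧ y < 0) := by
    rcases lt_or_gt_of_ne hy0 with h | h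
    · exact ⟨-1, Or.inr ⟨rfl, h⟩⟩
    · exact ⟨1, Or.inl ⟨rfl, h⟩⟩
  have hmem : ∀ i, i ≠ y → (x, i) ∈ A → (x, i) ∈ insert (x, y') (A.erase (x, y)) := by
    intro i h1 h2
    simp [h1, h2]
  have hw : (x, y - s) ∈ insert (x, y') (A.erase (x, y)) := by
    by_cases h : y - s = y'
    · rw [h]; exact Finset.mem_insert_self _ _
    · exact hmem _ (by omega) (hrun _ (by omega) (by omega))
  refine ⟨x, y, y', hne, hy0, hto, hvA, fun i hi => hrun i (by omega) (by omega), ?_, ?_⟩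
  · refine hA.replace huA hw (link_col fun i hi => ?_) ?_
    · by_cases h : i = y'
      · rw [h]; exact Finset.mem_insert_self _ _
      · exact hmem _ (by omega) (hrun _ (by omega) (by omega))
    · rintro ⟨a, b⟩ hz hzu hn
      have hz' : (a, b) ∈ insert (x, y') (A.erase (x, y)) :=
        Finset.mem_insert_of_mem (Finset.mem_erase.2 ⟨hzu, hz⟩)
      simp only [Near] at hn
      by_cases hb : b = y + s
      · have hng : ¬ HasGap A a b := fun h => by have := hmax' a b hz h; omega
        by_cases ha : a = x
        · subst ha
          exact absurd ⟨y', by unfold Toward; omega, hvA⟩ hng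
        · have hay : (a, y) ∈ A := by
            by_contra h
            exact hng ⟨y, by unfold Toward; omega, h⟩
          have hay' : (a, y) ∈ insert (x, y') (A.erase (x, y)) := by simp [hay, ha]
          exact (Link.of_near hw hay' (by simp only [Near]; omega)).trans
            (Link.of_near hay' hz' (by simp only [Near]; omega))
      · refine Link.of_near hw hz' ?_
        have : ¬ (a = x ∧ b = y) := fun h => hzu (by rw [h.1, h.2])
        simp only [Near]; omega
  · apply Finset.card_lt_card
    rw [Finset.ssubset_iff_of_subset]
    · refine ⟨(x, y), ?_, ?_⟩
      · exact Finset.mem_filter.2 ⟨hAB huA, y, huA, hgap, by unfold Toward; omega, hy0⟩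
      · intro h
        obtain ⟨-, b, hb, ⟨i, hi1, hi2⟩, hb2, -⟩ := Finset.mem_filter.1 h
        simp only [Toward] at hb hb2 hi1
        simp only [Finset.mem_insert, Finset.mem_erase, Prod.mk.injEq, true_and, not_or] at hb hi2
        have hb' : (x, b) ∈ A := by
          rcases hb with hb | hb
          · omega
          · exact hb.2
        by_cases hby : b = y
        · subst hby
          rcases hb with hb | hb
          · exact hne hb
          · exact hb.1 rfl
        · have := hmax' x b hb' ⟨y', by unfold Toward; omega, hvA⟩
          omega
    · rintro ⟨a, b⟩ h
      obtain ⟨hB, c, hc, ⟨i, hi1, hi2⟩, hc2, hb0⟩ := Finset.mem_filter.1 h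
      refine Finset.mem_filter.2 ⟨hB, ?_⟩
      simp only [Toward] at hc hc2 hi1 hb0 ⊢
      simp only [Finset.mem_insert, Finset.mem_erase, Prod.mk.injEq, not_or, not_and] at hc hi2
      rcases hc with ⟨rfl, rfl⟩ | ⟨hc0, hc⟩
      · exact ⟨y, huA, hgap, by omega, hb0⟩
      · by_cases hi : a = x ∧ i = y
        · obtain ⟨rfl, rfl⟩ := hi
          exact ⟨c, hc, ⟨y', by unfold Toward; omega, hvA⟩, hc2, hb0⟩
        · refine ⟨c, hc, ⟨i, hi1, hi2.2 ?_⟩, hc2, hb0⟩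
          intro h1; exact hi (Prod.mk.inj h1)

/-- Gathering: a connected part `A ⊆ B` of a shape `A ∪ R` is turned into a comb within `B`, unless
it comes near another cell of the shape in `B`. The contact cell `c` in row `0`, which holds `A`
and `R` together, stays in place. -/
theorem exists_comb {W : Set Pt} {B R : Finset Pt} {c : Pt} (hc : c.2 = 0)
    (hBW : ∀ u ∈ B, u ∈ W) (hRW : ∀ u ∈ R, u ∈ W) (hR : Conn (insert c R))
    (hB : ∀ x y y', (x, y) ∈ B → Toward y y' → (x, y') ∈ B)
    {A : Finset Pt} (hAB : A ⊆ B) (hA : Conn A) (hcA : c ∈ A) (hAR : Disjoint A R) :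
    ∃ A', Tr W (gapCells B A).card (A ∪ R) (A' ∪ R) ∧ A' ⊆ B ∧ Conn A' ∧ c ∈ A' ∧ Disjoint A' R ∧
      ((∃ a ∈ A', ∃ r ∈ R, r ∈ B ∧ Near a r) ∨ IsComb A') := by
  classical
  have hconn : ∀ A, Conn A → c ∈ A → Conn (A ∪ R) := fun A h1 h2 => by
    have := h1.union_of_near hR h2 (Finset.mem_insert_self c R) (Near.refl c)
    rwa [Finset.union_insert, Finset.insert_eq_self.2 (Finset.mem_union_left _ h2)] at this
  have hsub : ∀ A, A ⊆ B → ∀ u ∈ A ∪ R, u ∈ W := fun A h u hu => by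
    rcases Finset.mem_union.1 hu with hu | hu
    · exact hBW u (h hu)
    · exact hRW u hu
  generalize hN : (gapCells B A).card = N
  induction N using Nat.strong_induction_on generalizing A with
  | _ N ih =>
  by_cases hend : (∃ a ∈ A, ∃ r ∈ R, r ∈ B ∧ Near a r) ∨ IsComb A
  · exact ⟨A, Tr.refl _ (hconn A hA hcA) (hsub A hAB), hAB, hA, hcA, hAR, hend⟩
  · rw [not_or] at hend
    obtain ⟨x, y, y', hne, hy0, hto, hvA, hrun, hA1, hlt⟩ := exists_drop hAB hA hend.2
    have huA : (x, y) ∈ A := hrun y (by omega)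
    have hvB : (x, y') ∈ B := hB x y y' (hAB huA) hto
    have hvR : (x, y') ∉ R := by
      intro hvR
      refine hend.1 ⟨(x, if y < y' then y' - 1 else y' + 1), hrun _ (by split_ifs <;> omega), _, hvR, hvB, ?_⟩
      simp only [Near]; split_ifs <;> omega
    have huR : (x, y) ∉ R := Finset.disjoint_left.1 hAR huA
    have hcA1 : c ∈ insert (x, y') (A.erase (x, y)) := by
      refine Finset.mem_insert_of_mem (Finset.mem_erase.2 ⟨?_, hcA⟩)
      rintro rfl; exact hy0 hc
    have hA1B : insert (x, y') (A.erase (x, y)) ⊆ B :=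
      Finset.insert_subset hvB ((Finset.erase_subset _ _).trans hAB)
    have hA1R : Disjoint (insert (x, y') (A.erase (x, y))) R := by
      rw [Finset.disjoint_insert_left]
      exact ⟨hvR, hAR.mono_left (Finset.erase_subset _ _)⟩
    obtain ⟨A', hT, h⟩ := ih _ (hN ▸ hlt) hA1B hA1 hcA1 hA1R rfl
    refine ⟨A', ?_, h⟩
    have hstep : Mv (A ∪ R) (insert (x, y') (A.erase (x, y)) ∪ R) := by
      refine Or.inr ⟨x, y, y', hne, fun i hi => Finset.mem_union_left _ (hrun i hi), ?_, ?_⟩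
      · simp [hvA, hvR]
      · rw [Finset.erase_union_distrib, Finset.erase_eq_of_notMem huR, Finset.insert_union]
    exact ((Tr.single (hconn A hA hcA) (hsub A hAB) hstep (hconn _ hA1 hcA1)
      (hsub _ hA1B)).trans hT).mono (by omega)

/-! ### Passing a comb through a single cell -/

/-- A comb that lies in the columns `x ≤ 0` and whose part in row `0` extends without interruption
to the cell `(0, 0)`. Its cells can be pushed out one by one along row `0`. -/
structure IsFeeder (A : Finset Pt) : Prop where
  nonpos : ∀ u ∈ A, u.1 ≤ 0
  comb : IsComb A
  row : ∀ x y x', (x, y) ∈ A → x ≤ x' → x' ≤ 0 → (x', 0) ∈ A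

/-- The rectangle of cells `(x, y)` with `1 ≤ x ≤ X` and `Y₁ ≤ y ≤ Y₂`. -/
noncomputable def pocket (X Y₁ Y₂ : ℤ) : Finset Pt := Finset.Icc 1 X ×ˢ Finset.Icc Y₁ Y₂

theorem mem_pocket {X Y₁ Y₂ : ℤ} {u : Pt} :
    u ∈ pocket X Y₁ Y₂ ↔ (1 ≤ u.1 ∧ u.1 ≤ X) ∧ Y₁ ≤ u.2 ∧ u.2 ≤ Y₂ := by
  simp [pocket]

theorem Conn.union_of_link {E R : Finset Pt} {g : Pt} (hR : Conn R) (hg : g ∈ R)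
    (h : ∀ e ∈ E, Link (E ∪ R) e g) : Conn (E ∪ R) := by
  refine Conn.of_center (Finset.mem_union_right _ hg) fun u hu => ?_
  rcases Finset.mem_union.1 hu with hu | hu
  · exact (h u hu).symm
  · exact (hR.2 g hg u hu).mono Finset.subset_union_right

theorem IsFeeder.conn_union {A R : Finset Pt} (hA : IsFeeder A) (hR : Conn R)
    (hg : ((1, 0) : Pt) ∈ R) : Conn (A ∪ R) := by
  refine hR.union_of_link hg ?_
  rintro ⟨x, y⟩ he
  have hx : x ≤ 0 := hA.nonpos _ he
  refine (link_col (y' := 0) fun i hi => ?_).trans (link_row_of_le (by omega) fun i h1 h2 => ?_)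
  · exact Finset.mem_union_left _ (hA.comb x y i he (by unfold Toward; omega))
  · by_cases h : i ≤ 0
    · exact Finset.mem_union_left _ (hA.row x y i he h1 h)
    · obtain rfl : i = 1 := by omega
      exact Finset.mem_union_right _ hg

/-- Taking the first cell of row `0` out of a feeder leaves it attached: what is left of the
first column is diagonally adjacent to the next cell of row `0`. -/
theorem IsFeeder.conn_erase_union {A R : Finset Pt} (hA : IsFeeder A) (hR : Conn R)
    (hg : ((1, 0) : Pt) ∈ R) {l : ℤ} (hl : ∀ u ∈ A, l ≤ u.1) :
    Conn (A.erase (l, 0) ∪ R) := by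
  refine hR.union_of_link hg ?_
  rintro ⟨x, y⟩ he'
  obtain ⟨hne, he⟩ := Finset.mem_erase.1 he'
  have hx : x ≤ 0 := hA.nonpos _ he
  have hlx : l ≤ x := hl _ he
  have hmem : ∀ a b, (a, b) ∈ A → ¬ (a = l ∧ b = 0) → (a, b) ∈ A.erase (l, 0) ∪ R := by
    intro a b h1 h2
    refine Finset.mem_union_left _ (Finset.mem_erase.2 ⟨fun h => h2 (Prod.mk.inj h), h1⟩)
  have hrow : ∀ i, x ≤ i → l < i → i ≤ 1 → (i, (0 : ℤ)) ∈ A.erase (l, 0) ∪ R := by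
    intro i h1 h2 h3
    by_cases h : i ≤ 0
    · exact hmem i 0 (hA.row x y i he h1 h) (by omega)
    · obtain rfl : i = 1 := by omega
      exact Finset.mem_union_right _ hg
  by_cases hxl : x = l
  · subst hxl
    have hy : y ≠ 0 := fun h => hne (by rw [h])
    obtain ⟨s, hs⟩ : ∃ s : ℤ, (s = 1 ∧ 0 < y) ∨ (s = -1 ∧ y < 0) := by
      rcases lt_or_gt_of_ne hy with h | h
      · exact ⟨-1, Or.inr ⟨rfl, h⟩⟩
      · exact ⟨1, Or.inl ⟨rfl, h⟩⟩
    have hs' : (x, s) ∈ A.erase (x, 0) ∪ R :=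
      hmem x s (hA.comb x y s he (by unfold Toward; omega)) (by omega)
    refine (link_col (y' := s) fun i hi => ?_).trans
      ((Link.of_near (v := (x + 1, 0)) hs' (hrow _ (by omega) (by omega) (by omega)) ?_).trans
      (link_row_of_le (by omega) fun i h1 h2 => hrow i (by omega) (by omega) h2))
    · exact hmem x i (hA.comb x y i he (by unfold Toward; omega)) (by omega)
    · simp only [Near]; omega
  · refine (link_col (y' := 0) fun i hi => ?_).trans (link_row_of_le (by omega) fun i h1 h2 => ?_)
    · exact hmem x i (hA.comb x y i he (by unfold Toward; omega)) (by omega)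
    · exact hrow i h1 (by omega) h2

section Push

variable {W : Set Pt} {A R : Finset Pt} {X Y₁ Y₂ l : ℤ}

/-- One cell of row `0` of a feeder is pushed into the pocket. If row `0` of the pocket is full,
room is made first by pushing a cell of this row vertically into a hole of the pocket. -/
theorem IsFeeder.push_row (hA : IsFeeder A) (hAR : Disjoint A R) (hc : Conn (A ∪ R))
    (hR : Conn (insert (1, 0) R)) (hW : ∀ u ∈ A ∪ R, u ∈ W)
    (hX : 1 ≤ X) (hY₁ : Y₁ ≤ 0) (hY₂ : 0 ≤ Y₂) (hPW : ∀ u ∈ pocket X Y₁ Y₂, u ∈ W)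
    (hcap : ((A ∪ R).card : ℤ) ≤ (X - 1) * (Y₂ - Y₁ + 1)) (hlA : (l, 0) ∈ A)
    (hl : ∀ u ∈ A, l ≤ u.1) :
    ∃ z, z ∉ A ∪ R ∧ z ∈ pocket X Y₁ Y₂ ∧ Conn (insert z R) ∧ ((1, 0) : Pt) ∈ insert z R ∧
      (z = (1, 0) ∨ ((1, 0) : Pt) ∈ R ∧ ∃ t ∈ R, t ∈ pocket X Y₁ Y₂ ∧ Near t z) ∧
      Tr W 2 (A ∪ R) (A.erase (l, 0) ∪ insert z R) := by
  classical
  have hl0 : l ≤ 0 := hA.nonpos _ hlA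
  have hpA : ∀ u ∈ A, ∀ a b : ℤ, 1 ≤ a → u ≠ (a, b) := by
    rintro u hu a b h rfl; have := hA.nonpos _ hu; simp only at this; omega
  have hlR : (l, (0 : ℤ)) ∉ R := Finset.disjoint_left.1 hAR hlA
  by_cases hrow : ∃ x, (1 ≤ x ∧ x ≤ X) ∧ (x, (0 : ℤ)) ∉ R
  · obtain ⟨x, hx, hmin⟩ : ∃ x ∈ (Finset.Icc 1 X).filter (fun x => (x, (0 : ℤ)) ∉ R),
        ∀ x' ∈ (Finset.Icc 1 X).filter (fun x => (x, (0 : ℤ)) ∉ R), x ≤ x' := by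
      apply Finset.exists_min_image
      obtain ⟨x, h1, h2⟩ := hrow
      exact ⟨x, Finset.mem_filter.2 ⟨Finset.mem_Icc.2 h1, h2⟩⟩
    obtain ⟨hx1, hxR⟩ := Finset.mem_filter.1 hx
    rw [Finset.mem_Icc] at hx1
    have hrun : ∀ i, 1 ≤ i → i < x → (i, (0 : ℤ)) ∈ R := by
      intro i h1 h2
      by_contra h
      have := hmin i (Finset.mem_filter.2 ⟨Finset.mem_Icc.2 (by omega), h⟩)
      omega
    have hxA : (x, (0 : ℤ)) ∉ A := fun h => hpA _ h x 0 hx1.1 rfl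
    have hzP : (x, (0 : ℤ)) ∈ pocket X Y₁ Y₂ := mem_pocket.2 (by simp only; omega)
    have hRz : Conn (insert (x, 0) R) ∧ ((1, 0) : Pt) ∈ insert (x, 0) R ∧
        ((x, 0) = ((1, 0) : Pt) ∨ ((1, 0) : Pt) ∈ R ∧
          ∃ t ∈ R, t ∈ pocket X Y₁ Y₂ ∧ Near t (x, 0)) := by
      by_cases h : x = 1
      · subst h; exact ⟨hR, Finset.mem_insert_self _ _, Or.inl rfl⟩
      · have hg := hrun 1 le_rfl (by omega)
        have ht := hrun (x - 1) (by omega) (by omega)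
        rw [Finset.insert_eq_self.2 hg] at hR
        have hn : Near (x - 1, 0) (x, 0) := by simp only [Near]; omega
        exact ⟨hR.insert_of_near ht hn, Finset.mem_insert_of_mem hg, Or.inr ⟨hg, _, ht,
          mem_pocket.2 (by simp only; omega), hn⟩⟩
    refine ⟨(x, 0), by simp [hxA, hxR], hzP, hRz.1, hRz.2.1, hRz.2.2, ?_⟩
    refine (Tr.single hc hW (Or.inl ⟨l, x, 0, by omega, ?_, by simp [hxA, hxR], ?_⟩)
      (hA.conn_erase_union hRz.1 hRz.2.1 hl) ?_).mono (by omega)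
    · intro i hi
      by_cases h : i ≤ 0
      · exact Finset.mem_union_left _ (hA.row l 0 i hlA (by omega) h)
      · exact Finset.mem_union_right _ (hrun i (by omega) (by omega))
    · rw [Finset.erase_union_distrib, Finset.erase_eq_of_notMem hlR, Finset.union_insert]
    · intro u hu
      rcases Finset.mem_union.1 hu with hu | hu
      · exact hW u (Finset.mem_union_left _ (Finset.mem_of_mem_erase hu))
      · rcases Finset.mem_insert.1 hu with rfl | hu
        · exact hPW _ hzP
        · exact hW u (Finset.mem_union_right _ hu)
  · push Not at hrow
    have hg : ((1, 0) : Pt) ∈ R := hrow 1 ⟨le_rfl, hX⟩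
    rw [Finset.insert_eq_self.2 hg] at hR
    obtain ⟨x, y₁, hx1, hxX, hy₁, hy₂, hq⟩ : ∃ x y, 1 ≤ x ∧ x ≤ X - 1 ∧ Y₁ ≤ y ∧ y ≤ Y₂ ∧
        (x, y) ∉ R := by
      by_contra h
      push Not at h
      have hsub : pocket (X - 1) Y₁ Y₂ ⊆ R := by
        rintro ⟨x, y⟩ hu
        have := mem_pocket.1 hu
        exact h x y this.1.1 this.1.2 this.2.1 this.2.2
      have h1 := Finset.card_le_card hsub
      have h2 : (pocket (X - 1) Y₁ Y₂).card = (X - 1).toNat * (Y₂ - Y₁ + 1).toNat := by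
        simp only [pocket, Finset.card_product, Int.card_Icc]
        congr 2 <;> omega
      have h3 : (A ∪ R).card = A.card + R.card := Finset.card_union_of_disjoint hAR
      have h4 := Finset.card_pos.2 ⟨_, hlA⟩
      have h5 : ((pocket (X - 1) Y₁ Y₂).card : ℤ) = (X - 1) * (Y₂ - Y₁ + 1) := by
        rw [h2]; push_cast; rw [Int.toNat_of_nonneg (by omega), Int.toNat_of_nonneg (by omega)]
      rw [← h5] at hcap
      omega
    obtain ⟨y, hy, hmin⟩ : ∃ y ∈ (Finset.Icc Y₁ Y₂).filter (fun y => Toward y₁ y ∧ (x, y) ∉ R),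
        ∀ y' ∈ (Finset.Icc Y₁ Y₂).filter (fun y => Toward y₁ y ∧ (x, y) ∉ R),
          y.natAbs ≤ y'.natAbs := by
      apply Finset.exists_min_image
      exact ⟨y₁, Finset.mem_filter.2 ⟨Finset.mem_Icc.2 ⟨hy₁, hy₂⟩, by unfold Toward; omega, hq⟩⟩
    obtain ⟨hyI, hto, hyR⟩ := Finset.mem_filter.1 hy
    rw [Finset.mem_Icc] at hyI
    unfold Toward at hto
    have hy0 : y ≠ 0 := by rintro rfl; exact hyR (hrow x ⟨hx1, by omega⟩)
    have hrun : ∀ i, Toward y i → i ≠ y → (x, i) ∈ R := by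
      intro i h1 h2
      unfold Toward at h1
      by_contra h
      have := hmin i (Finset.mem_filter.2
        ⟨Finset.mem_Icc.2 (by omega), by unfold Toward; omega, h⟩)
      omega
    have hyA : (x, y) ∉ A := fun h => hpA _ h x y hx1 rfl
    have hzS : (x, y) ∉ A ∪ R := by simp [hyA, hyR]
    have hzP : (x, y) ∈ pocket X Y₁ Y₂ := mem_pocket.2 (by simp only; omega)
    obtain ⟨s, hs⟩ : ∃ s : ℤ, (s = 1 ∧ 0 < y) ∨ (s = -1 ∧ y < 0) := by
      rcases lt_or_gt_of_ne hy0 with h | h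
      · exact ⟨-1, Or.inr ⟨rfl, h⟩⟩
      · exact ⟨1, Or.inl ⟨rfl, h⟩⟩
    have huR : (x, (0 : ℤ)) ∈ R := hrow x ⟨hx1, by omega⟩
    have huA : (x, (0 : ℤ)) ∉ A := fun h => hpA _ h x 0 hx1 rfl
    have ht : (x, y - s) ∈ R := hrun _ (by unfold Toward; omega) (by omega)
    have hn : Near (x, y - s) (x, y) := by simp only [Near]; omega
    have hRz : Conn (insert (x, y) R) := hR.insert_of_near ht hn
    have hfull : ∀ i, l ≤ i → i ≤ X → (i, (0 : ℤ)) ∈ A ∪ R := by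
      intro i h1 h2
      by_cases h : i ≤ 0
      · exact Finset.mem_union_left _ (hA.row l 0 i hlA (by omega) h)
      · exact Finset.mem_union_right _ (hrow i (by omega))
    have hmem : ∀ a b, (a, b) ∈ A ∪ R → ¬ (a = x ∧ b = 0) →
        (a, b) ∈ insert (x, y) ((A ∪ R).erase (x, 0)) := fun a b h1 h2 =>
      Finset.mem_insert_of_mem (Finset.mem_erase.2 ⟨fun h => h2 (Prod.mk.inj h), h1⟩)
    have hcol : ∀ i, Toward y i → i ≠ 0 → (x, i) ∈ insert (x, y) ((A ∪ R).erase (x, 0)) := by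
      intro i h1 h2
      by_cases h : i = y
      · rw [h]; exact Finset.mem_insert_self _ _
      · exact hmem x i (Finset.mem_union_right _ (hrun i h1 h)) (by omega)
    have hw := hcol s (by unfold Toward; omega) (by omega)
    have hc1 : Conn (insert (x, y) ((A ∪ R).erase (x, 0))) := by
      refine hc.replace (Finset.mem_union_right _ huR) hw (link_col fun i hi => ?_) ?_
      · exact hcol i (by unfold Toward; omega) (by omega)
      · rintro ⟨a, b⟩ hz hne hnear
        simp only [Near] at hnear
        have hz' := hmem a b hz (fun h => hne (by rw [h.1, h.2]))
        obtain ⟨e, he⟩ : ∃ e : ℤ, (e = 1 ∧ a = x + 1) ∨ (e = -1 ∧ a ≤ x) := by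
          by_cases h : a = x + 1
          · exact ⟨1, Or.inl ⟨rfl, h⟩⟩
          · exact ⟨-1, Or.inr ⟨rfl, by omega⟩⟩
        have hm := hmem (x + e) 0 (hfull _ (by omega) (by omega)) (by omega)
        refine (Link.of_near hw hm ?_).trans (Link.of_near hm hz' ?_) <;>
          simp only [Near] <;> omega
    have hW1 : ∀ u ∈ insert (x, y) ((A ∪ R).erase (x, 0)), u ∈ W := by
      intro u hu
      rcases Finset.mem_insert.1 hu with rfl | hu
      · exact hPW _ hzP
      · exact hW u (Finset.mem_of_mem_erase hu)
    have hm1 : Mv (A ∪ R) (insert (x, y) ((A ∪ R).erase (x, 0))) := by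
      refine Or.inr ⟨x, 0, y, hy0.symm, fun i hi => Finset.mem_union_right _ ?_, hzS, rfl⟩
      exact hrun i (by unfold Toward; omega) (by omega)
    have hm2 : Mv (insert (x, y) ((A ∪ R).erase (x, 0))) (A.erase (l, 0) ∪ insert (x, y) R) := by
      refine Or.inl ⟨l, x, 0, by omega, fun i hi => hmem i 0 (hfull i (by omega) (by omega))
        (by omega), ?_, ?_⟩
      · simp [hy0.symm]
      · ext q
        have h1 : (x, (0 : ℤ)) ≠ (l, 0) := fun h => by have := (Prod.mk.inj h).1; omega
        have h2 : (x, y) ≠ (l, (0 : ℤ)) := fun h => hy0 (Prod.mk.inj h).2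
        simp only [Finset.mem_union, Finset.mem_insert, Finset.mem_erase]
        by_cases hq1 : q = (l, 0)
        · subst hq1
          simp [hlR, h1.symm, h2.symm]
        · by_cases hq2 : q = (x, 0)
          · subst hq2; simp [huR]
          · simp [hq1, hq2]; tauto
    refine ⟨(x, y), hzS, hzP, hRz, Finset.mem_insert_of_mem hg, Or.inr ⟨hg, _, ht,
      mem_pocket.2 (by simp only; omega), hn⟩, ?_⟩
    refine (Tr.single hc hW hm1 hc1 hW1).tail hm2
      (hA.conn_erase_union hRz (Finset.mem_insert_of_mem hg) hl) ?_
    intro u hu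
    rcases Finset.mem_union.1 hu with hu | hu
    · exact hW u (Finset.mem_union_left _ (Finset.mem_of_mem_erase hu))
    · rcases Finset.mem_insert.1 hu with rfl | hu
      · exact hPW _ hzP
      · exact hW u (Finset.mem_union_right _ hu)

/-- A feeder loses one cell to the pocket by at most three moves and is a feeder again: after a
push along row `0`, the gap in the first column is closed from its far end. -/
theorem IsFeeder.push (hA : IsFeeder A) (hne : A.Nonempty) (hAR : Disjoint A R)
    (hc : Conn (A ∪ R)) (hR : Conn (insert (1, 0) R)) (hW : ∀ u ∈ A ∪ R, u ∈ W)
    (hX : 1 ≤ X) (hY₁ : Y₁ ≤ 0) (hY₂ : 0 ≤ Y₂) (hPW : ∀ u ∈ pocket X Y₁ Y₂, u ∈ W)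
    (hcap : ((A ∪ R).card : ℤ) ≤ (X - 1) * (Y₂ - Y₁ + 1)) :
    ∃ a ∈ A, ∃ z, z ∉ A ∪ R ∧ z ∈ pocket X Y₁ Y₂ ∧ Conn (insert z R) ∧
      ((1, 0) : Pt) ∈ insert z R ∧
      (z = (1, 0) ∨ ((1, 0) : Pt) ∈ R ∧ ∃ t ∈ R, t ∈ pocket X Y₁ Y₂ ∧ Near t z) ∧
      IsFeeder (A.erase a) ∧ Tr W 3 (A ∪ R) (A.erase a ∪ insert z R) := by
  classical
  obtain ⟨⟨l, y₀⟩, hlA, hl⟩ := Finset.exists_min_image A (fun u => u.1) hne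
  simp only at hl
  have hl0A : (l, (0 : ℤ)) ∈ A := hA.row l y₀ l hlA le_rfl (hA.nonpos _ hlA)
  obtain ⟨z, hz, hzP, hRz, hgz, hzz, hT⟩ :=
    hA.push_row hAR hc hR hW hX hY₁ hY₂ hPW hcap hl0A hl
  by_cases hcol : ∃ y, y ≠ 0 ∧ (l, y) ∈ A
  · -- the cell of the first column that is farthest from row `0`
    obtain ⟨⟨l', y⟩, hy, hmax⟩ : ∃ u ∈ A.filter (fun u => u.1 = l),
        ∀ v ∈ A.filter (fun u => u.1 = l), v.2.natAbs ≤ u.2.natAbs :=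
      Finset.exists_max_image (A.filter fun u => u.1 = l) (fun u => u.2.natAbs)
        ⟨(l, y₀), Finset.mem_filter.2 ⟨hlA, rfl⟩⟩
    obtain ⟨hyA, h⟩ := Finset.mem_filter.1 hy
    simp only at h
    subst h
    have hmax' : ∀ i, (l', i) ∈ A → i.natAbs ≤ y.natAbs := fun i hi =>
      hmax (l', i) (Finset.mem_filter.2 ⟨hi, rfl⟩)
    have hy0 : y ≠ 0 := by
      rintro rfl
      obtain ⟨i, hi0, hi⟩ := hcol
      have := hmax' i hi
      omega
    have hF : IsFeeder (A.erase (l', y)) := by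
      refine ⟨fun u hu => hA.nonpos u (Finset.mem_of_mem_erase hu), ?_, ?_⟩
      · intro a b b' h1 h2
        obtain ⟨h3, h4⟩ := Finset.mem_erase.1 h1
        refine Finset.mem_erase.2 ⟨?_, hA.comb a b b' h4 h2⟩
        rintro h5
        obtain ⟨rfl, rfl⟩ := Prod.mk.inj h5
        have := hmax' b h4
        unfold Toward at h2
        exact h3 (by rw [show b = b' by omega])
      · intro a b a' h1 h2 h3
        refine Finset.mem_erase.2 ⟨fun h => hy0 (Prod.mk.inj h).2.symm,
          hA.row a b a' (Finset.mem_of_mem_erase h1) h2 h3⟩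
    refine ⟨(l', y), hyA, z, hz, hzP, hRz, hgz, hzz, hF, ?_⟩
    have hzl : ∀ b, z ≠ (l', b) := by
      rintro b rfl
      have := (mem_pocket.1 hzP).1.1
      have := hA.nonpos _ hlA
      simp only at *
      omega
    have hyR : (l', y) ∉ R := Finset.disjoint_left.1 hAR hyA
    have hl0R : (l', (0 : ℤ)) ∉ R := Finset.disjoint_left.1 hAR hl0A
    refine hT.tail (Or.inr ⟨l', y, 0, hy0, fun i hi => ?_, ?_, ?_⟩) (hF.conn_union hRz hgz) ?_
    · refine Finset.mem_union_left _ (Finset.mem_erase.2 ⟨?_, hA.comb l' y i hyA ?_⟩)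
      · intro h; have := (Prod.mk.inj h).2; omega
      · unfold Toward; omega
    · simp [hl0R, (hzl 0).symm]
    · ext q
      simp only [Finset.mem_union, Finset.mem_insert, Finset.mem_erase]
      by_cases hq1 : q = (l', y)
      · subst hq1; simp [hyR, hy0, (hzl y).symm]
      · by_cases hq2 : q = (l', 0)
        · subst hq2; simp [hl0A, hy0.symm]
        · simp [hq1, hq2]
    · intro u hu
      rcases Finset.mem_union.1 hu with hu | hu
      · exact hW u (Finset.mem_union_left _ (Finset.mem_of_mem_erase hu))
      · exact hT.subset_right u (Finset.mem_union_right _ hu)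
  · push Not at hcol
    refine ⟨(l, 0), hl0A, z, hz, hzP, hRz, hgz, hzz, ?_, hT.mono (by omega)⟩
    have hlt : ∀ a b, (a, b) ∈ A.erase (l, 0) → l < a := by
      intro a b h
      obtain ⟨h1, h2⟩ := Finset.mem_erase.1 h
      refine lt_of_le_of_ne (hl _ h2) ?_
      rintro rfl
      by_cases hb : b = 0
      · exact h1 (by rw [hb])
      · exact hcol b hb h2
    refine ⟨fun u hu => hA.nonpos u (Finset.mem_of_mem_erase hu), ?_, ?_⟩
    · intro a b b' h1 h2
      have := hlt a b h1
      refine Finset.mem_erase.2 ⟨fun h => ?_, hA.comb a b b' (Finset.mem_of_mem_erase h1) h2⟩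
      have := (Prod.mk.inj h).1
      omega
    · intro a b a' h1 h2 h3
      have := hlt a b h1
      refine Finset.mem_erase.2 ⟨fun h => ?_, hA.row a b a' (Finset.mem_of_mem_erase h1) h2 h3⟩
      have := (Prod.mk.inj h).1
      omega

/-- A feeder `A` attached to `R` through the cell `(1, 0)` is moved into the pocket, cell by cell.
The property `D` records what is known about the part of the shape outside the feeder; it only has
to survive the addition of a pocket cell near another pocket cell. -/
theorem IsFeeder.transfer {D : Finset Pt → Prop}
    (hD : ∀ T z t, D T → z ∈ pocket X Y₁ Y₂ → t ∈ T → t ∈ pocket X Y₁ Y₂ → Near t z →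
      D (insert z T))
    (hA : IsFeeder A) (hAR : Disjoint A R)
    (hc : Conn (A ∪ R)) (hR : Conn (insert (1, 0) R)) (hDR : D (insert (1, 0) R))
    (hW : ∀ u ∈ A ∪ R, u ∈ W)
    (hX : 1 ≤ X) (hY₁ : Y₁ ≤ 0) (hY₂ : 0 ≤ Y₂) (hPW : ∀ u ∈ pocket X Y₁ Y₂, u ∈ W)
    (hcap : ((A ∪ R).card : ℤ) ≤ (X - 1) * (Y₂ - Y₁ + 1)) (hne : A.Nonempty) :
    ∃ T, Tr W (3 * A.card) (A ∪ R) T ∧ D T := by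
  classical
  generalize hN : A.card = N
  induction N generalizing A R with
  | zero => rw [Finset.card_eq_zero] at hN; simp [hN] at hne
  | succ N ih =>
    obtain ⟨a, ha, z, hz, hzP, hRz, hgz, hzz, hF, hT⟩ :=
      hA.push hne hAR hc hR hW hX hY₁ hY₂ hPW hcap
    have hDz : D (insert z R) := by
      rcases hzz with rfl | ⟨hg, t, ht, htP, hn⟩
      · exact hDR
      · rw [Finset.insert_eq_self.2 hg] at hDR
        exact hD R z t hDR hzP ht htP hn
    have hN' : (A.erase a).card = N := by rw [Finset.card_erase_of_mem ha]; omega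
    by_cases he : (A.erase a).Nonempty
    · have hdis : Disjoint (A.erase a) (insert z R) := by
        rw [Finset.disjoint_insert_right]
        exact ⟨fun h => hz (Finset.mem_union_left _ (Finset.mem_of_mem_erase h)),
          hAR.mono_left (Finset.erase_subset _ _)⟩
      have hins := Finset.insert_eq_self.2 hgz
      obtain ⟨T, hT', hDT⟩ := ih hF hdis hT.conn_right (hins.symm ▸ hRz) (hins.symm ▸ hDz)
        hT.subset_right (by rwa [hT.card_eq]) he hN'
      exact ⟨T, (hT.trans hT').mono (by omega), hDT⟩
    · rw [Finset.not_nonempty_iff_eq_empty] at he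
      rw [he, Finset.empty_union] at hT
      exact ⟨_, hT.mono (by omega), hDz⟩

end Push

/-- Crossing, in a frame where the contact cell is `(0, 0)` and the pocket begins in column `1`:
a connected part `A` of the shape is gathered around row `0` and pushed into the pocket through
the cell `(1, 0)`. Should `A` come near another cell of the shape in `B` while it is being
gathered, the process stops there. -/
theorem exists_cross_local {W : Set Pt} {A B R : Finset Pt} {X Y₁ Y₂ : ℤ} {D : Finset Pt → Prop}
    (hBW : ∀ u ∈ B, u ∈ W) (hRW : ∀ u ∈ R, u ∈ W)
    (hB : ∀ x y y', (x, y) ∈ B → Toward y y' → (x, y') ∈ B) (hB0 : ∀ u ∈ B, u.1 ≤ 0)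
    (hAB : A ⊆ B) (hA : Conn A) (hcA : ((0, 0) : Pt) ∈ A) (hAR : Disjoint A R)
    (hR0 : Conn (insert (0, 0) R)) (hR1 : Conn (insert (1, 0) R)) (hDR : D (insert (1, 0) R))
    (hD : ∀ T z t, D T → z ∈ pocket X Y₁ Y₂ → t ∈ T → t ∈ pocket X Y₁ Y₂ → Near t z →
      D (insert z T))
    (hDA : ∀ A', A' ⊆ B → Conn A' → (∃ a ∈ A', ∃ r ∈ R, r ∈ B ∧ Near a r) → D (A' ∪ R))
    (hX : 1 ≤ X) (hY₁ : Y₁ ≤ 0) (hY₂ : 0 ≤ Y₂) (hPW : ∀ u ∈ pocket X Y₁ Y₂, u ∈ W)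
    (hcap : ((A ∪ R).card : ℤ) ≤ (X - 1) * (Y₂ - Y₁ + 1)) :
    ∃ T, Tr W (B.card + 3 * A.card) (A ∪ R) T ∧ D T := by
  classical
  obtain ⟨A', hT, hA'B, hA', hcA', hA'R, h⟩ :=
    exists_comb (c := (0, 0)) rfl hBW hRW hR0 hB hAB hA hcA hAR
  have hle : (gapCells B A).card ≤ B.card := Finset.card_le_card (Finset.filter_subset _ _)
  have hcard : A'.card = A.card := by
    have := hT.card_eq
    rw [Finset.card_union_of_disjoint hAR, Finset.card_union_of_disjoint hA'R] at this
    omega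
  rcases h with h | h
  · exact ⟨_, hT.mono (by omega), hDA A' hA'B hA' h⟩
  · have hF : IsFeeder A' := by
      refine ⟨fun u hu => hB0 u (hA'B hu), h, fun x y x' h1 h2 h3 => ?_⟩
      obtain ⟨⟨a, b⟩, hw, rfl⟩ := hA'.exists_fst_eq h1 hcA' h2 h3
      exact h a b 0 hw (by unfold Toward; omega)
    obtain ⟨T, hT', hDT⟩ := hF.transfer hD hA'R hT.conn_right hR1 hDR hT.subset_right hX hY₁ hY₂ hPW
      (by rwa [hT.card_eq]) ⟨_, hcA'⟩
    exact ⟨T, (hT.trans hT').mono (by omega), hDT⟩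

/-! ### Frames in the four directions -/

/-- The four axis directions. -/
def IsDir (d : Pt) : Prop := d = (1, 0) ∨ d = (-1, 0) ∨ d = (0, 1) ∨ d = (0, -1)

/-- The rotated and translated frame with origin `c` whose first axis points in direction `d`. -/
def frame (c d p : Pt) : Pt := (c.1 + d.1 * p.1 - d.2 * p.2, c.2 + d.2 * p.1 + d.1 * p.2)

/-- The frame with origin `c` and direction `d` as a permutation of the cells. -/
def frameEquiv (c d : Pt) (hd : IsDir d) : Pt ≃ Pt where
  toFun := frame c d
  invFun p := (d.1 * (p.1 - c.1) + d.2 * (p.2 - c.2), d.1 * (p.2 - c.2) - d.2 * (p.1 - c.1))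
  left_inv p := by
    rcases hd with rfl | rfl | rfl | rfl <;> ext <;> simp [frame]
  right_inv p := by
    rcases hd with rfl | rfl | rfl | rfl <;> ext <;> simp [frame]

/-- A permutation of the cells that respects neighbours and line moves. -/
structure IsRigid (e : Pt ≃ Pt) : Prop where
  near : ∀ u v, Near u v → Near (e u) (e v)
  mv : ∀ S S', Mv S S' → Mv (S.map e.toEmbedding) (S'.map e.toEmbedding)

theorem map_insert_erase (e : Pt ≃ Pt) (S : Finset Pt) (p q : Pt) :
    (insert q (S.erase p)).map e.toEmbedding =
      insert (e q) ((S.map e.toEmbedding).erase (e p)) := by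
  rw [Finset.map_insert, Finset.map_erase]; rfl

theorem frameEquiv_isRigid (c d : Pt) (hd : IsDir d) : IsRigid (frameEquiv c d hd) := by
  constructor
  · intro u v h
    simp only [Near, frameEquiv, Equiv.coe_fn_mk, frame] at h ⊢
    rcases hd with rfl | rfl | rfl | rfl <;> simp only <;> omega
  · intro S S' h
    have hmem : ∀ q, frame c d q ∈ S.map (frameEquiv c d hd).toEmbedding ↔ q ∈ S := fun q =>
      Finset.mem_map' (frameEquiv c d hd).toEmbedding
    have hap : ∀ p, frameEquiv c d hd p = frame c d p := fun _ => rfl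
    rcases h with ⟨x, x', y, hne, hr, hn, rfl⟩ | ⟨x, y, y', hne, hr, hn, rfl⟩
    · rw [map_insert_erase, hap, hap]
      have hn' := (hmem _).not.2 hn
      have hr' := fun i hi => (hmem _).2 (hr i hi)
      generalize S.map (frameEquiv c d hd).toEmbedding = M at hn' hr'
      rcases hd with rfl | rfl | rfl | rfl
      · refine Or.inl ⟨c.1 + x, c.1 + x', c.2 + y, by omega, fun i hi => ?_, ?_, ?_⟩
        · have := hr' (i - c.1) (by omega); simpa [frame] using this
        · simpa [frame] using hn'
        · simp [frame]
      · refine Or.inl ⟨c.1 - x, c.1 - x', c.2 - y, by omega, fun i hi => ?_, ?_, ?_⟩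
        · have := hr' (c.1 - i) (by omega); simpa [frame, ← sub_eq_add_neg] using this
        · simpa [frame, ← sub_eq_add_neg] using hn'
        · simp [frame, ← sub_eq_add_neg]
      · refine Or.inr ⟨c.1 - y, c.2 + x, c.2 + x', by omega, fun i hi => ?_, ?_, ?_⟩
        · have := hr' (i - c.2) (by omega); simpa [frame, ← sub_eq_add_neg] using this
        · simpa [frame, ← sub_eq_add_neg] using hn'
        · simp [frame]
      · refine Or.inr ⟨c.1 + y, c.2 - x, c.2 - x', by omega, fun i hi => ?_, ?_, ?_⟩
        · have := hr' (c.2 - i) (by omega); simpa [frame, ← sub_eq_add_neg] using this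
        · simpa [frame, ← sub_eq_add_neg] using hn'
        · simp [frame, ← sub_eq_add_neg]
    · rw [map_insert_erase, hap, hap]
      have hn' := (hmem _).not.2 hn
      have hr' := fun i hi => (hmem _).2 (hr i hi)
      generalize S.map (frameEquiv c d hd).toEmbedding = M at hn' hr'
      rcases hd with rfl | rfl | rfl | rfl
      · refine Or.inr ⟨c.1 + x, c.2 + y, c.2 + y', by omega, fun i hi => ?_, ?_, ?_⟩
        · have := hr' (i - c.2) (by omega); simpa [frame] using this
        · simpa [frame] using hn'
        · simp [frame]
      · refine Or.inr ⟨c.1 - x, c.2 - y, c.2 - y', by omega, fun i hi => ?_, ?_, ?_⟩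
        · have := hr' (c.2 - i) (by omega); simpa [frame, ← sub_eq_add_neg] using this
        · simpa [frame, ← sub_eq_add_neg] using hn'
        · simp [frame, ← sub_eq_add_neg]
      · refine Or.inl ⟨c.1 - y, c.1 - y', c.2 + x, by omega, fun i hi => ?_, ?_, ?_⟩
        · have := hr' (c.1 - i) (by omega); simpa [frame, ← sub_eq_add_neg] using this
        · simpa [frame, ← sub_eq_add_neg] using hn'
        · simp [frame]
      · refine Or.inl ⟨c.1 + y, c.1 + y', c.2 - x, by omega, fun i hi => ?_, ?_, ?_⟩
        · have := hr' (i - c.1) (by omega); simpa [frame, ← sub_eq_add_neg] using this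
        · simpa [frame, ← sub_eq_add_neg] using hn'
        · simp [frame, ← sub_eq_add_neg]

theorem Conn.map_of_near {e : Pt ≃ Pt} (he : ∀ u v, Near u v → Near (e u) (e v)) {T : Finset Pt}
    (hT : Conn T) : Conn (T.map e.toEmbedding) := by
  obtain ⟨w, hw⟩ := hT.1
  refine Conn.of_center (w := e w) (Finset.mem_map_of_mem _ hw) fun u hu => ?_
  obtain ⟨v, hv, rfl⟩ := Finset.mem_map.1 hu
  have h := hT.2 w hw v hv
  clear hu hv
  induction h with
  | refl => exact Relation.ReflTransGen.refl
  | tail _ h ih => exact ih.tail ⟨Finset.mem_map_of_mem _ h.1, Finset.mem_map_of_mem _ h.2.1,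
      he _ _ h.2.2⟩

theorem near_frameEquiv_symm (c d : Pt) (hd : IsDir d) (u v : Pt) (h : Near u v) :
    Near ((frameEquiv c d hd).symm u) ((frameEquiv c d hd).symm v) := by
  simp only [Near, frameEquiv, Equiv.coe_fn_symm_mk] at h ⊢
  rcases hd with rfl | rfl | rfl | rfl <;> simp only <;> omega

theorem Tr.map {e : Pt ≃ Pt} (he : IsRigid e) {W : Set Pt} {t : ℕ} {S S' : Finset Pt}
    (h : Tr (e ⁻¹' W) t S S') : Tr W t (S.map e.toEmbedding) (S'.map e.toEmbedding) := by
  induction h with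
  | refl t hc hW =>
    refine Tr.refl t (hc.map_of_near he.near) fun u hu => ?_
    obtain ⟨v, hv, rfl⟩ := Finset.mem_map.1 hu
    exact hW v hv
  | tail _ hm hc hW ih =>
    refine ih.tail (he.mv _ _ hm) (hc.map_of_near he.near) fun u hu => ?_
    obtain ⟨v, hv, rfl⟩ := Finset.mem_map.1 hu
    exact hW v hv

/-- Crossing in an arbitrary direction `d`: the part `A` of the shape, contained in `B`, is pushed
through its contact cell `c` into the pocket `P`, a rectangle that begins behind `c`. -/
theorem exists_cross {W : Set Pt} {A B P R : Finset Pt} {c d : Pt} {X Y₁ Y₂ : ℤ}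
    {D : Finset Pt → Prop} (hd : IsDir d)
    (hBW : ∀ u ∈ B, u ∈ W) (hRW : ∀ u ∈ R, u ∈ W)
    (hB : ∀ x y y', frame c d (x, y) ∈ B → Toward y y' → frame c d (x, y') ∈ B)
    (hB0 : ∀ u, frame c d u ∈ B → u.1 ≤ 0)
    (hP : ∀ u, frame c d u ∈ P ↔ u ∈ pocket X Y₁ Y₂)
    (hAB : A ⊆ B) (hA : Conn A) (hcA : c ∈ A) (hAR : Disjoint A R)
    (hR0 : Conn (insert c R)) (hR1 : Conn (insert (frame c d (1, 0)) R))
    (hDR : D (insert (frame c d (1, 0)) R))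
    (hD : ∀ T z t, D T → z ∈ P → t ∈ T → t ∈ P → Near t z → D (insert z T))
    (hDA : ∀ A', A' ⊆ B → Conn A' → (∃ a ∈ A', ∃ r ∈ R, r ∈ B ∧ Near a r) → D (A' ∪ R))
    (hX : 1 ≤ X) (hY₁ : Y₁ ≤ 0) (hY₂ : 0 ≤ Y₂) (hPW : ∀ u ∈ P, u ∈ W)
    (hcap : ((A ∪ R).card : ℤ) ≤ (X - 1) * (Y₂ - Y₁ + 1)) :
    ∃ T, Tr W (B.card + 3 * A.card) (A ∪ R) T ∧ D T := by
  classical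
  set e := frameEquiv c d hd with he
  have hap : ∀ p, frame c d p = e p := fun _ => rfl
  have hc : c = e (0, 0) := by rw [← hap]; simp [frame]
  simp only [hap] at *
  have hpull : ∀ (S : Finset Pt) (u : Pt), u ∈ S.map e.symm.toEmbedding ↔ e u ∈ S := by
    intro S u
    rw [Finset.mem_map_equiv, Equiv.symm_symm]
  have hback : ∀ S : Finset Pt, (S.map e.symm.toEmbedding).map e.toEmbedding = S := by
    intro S; ext u; simp
  have hnear : ∀ u v, Near u v → Near (e.symm u) (e.symm v) := near_frameEquiv_symm c d hd
  have hrig : IsRigid e := frameEquiv_isRigid c d hd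
  have hins : ∀ u, (insert (e u) R).map e.symm.toEmbedding =
      insert u (R.map e.symm.toEmbedding) := by
    intro u; rw [Finset.map_insert]; simp
  have hD' : ∀ (T : Finset Pt) z t, D (T.map e.toEmbedding) → z ∈ pocket X Y₁ Y₂ → t ∈ T →
      t ∈ pocket X Y₁ Y₂ → Near t z → D ((insert z T).map e.toEmbedding) := by
    intro T z t h1 h2 h3 h4 h5
    rw [Finset.map_insert]
    exact hD _ _ (e t) h1 ((hP z).2 h2) (Finset.mem_map_of_mem _ h3) ((hP t).2 h4)
      (hrig.near _ _ h5)
  have hDA' : ∀ A', A' ⊆ B.map e.symm.toEmbedding → Conn A' →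
      (∃ a ∈ A', ∃ r ∈ R.map e.symm.toEmbedding, r ∈ B.map e.symm.toEmbedding ∧ Near a r) →
      D ((A' ∪ R.map e.symm.toEmbedding).map e.toEmbedding) := by
    rintro A' h1 h2 ⟨a, ha, r, hr, hrB, h3⟩
    rw [Finset.map_union, hback]
    refine hDA _ ?_ (h2.map_of_near hrig.near) ⟨e a, Finset.mem_map_of_mem _ ha, e r,
      (hpull _ _).1 hr, (hpull _ _).1 hrB, hrig.near _ _ h3⟩
    have := Finset.map_subset_map (f := e.toEmbedding).2 h1
    rwa [hback] at this
  obtain ⟨T, hT, hDT⟩ := exists_cross_local (W := e ⁻¹' W) (A := A.map e.symm.toEmbedding)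
    (B := B.map e.symm.toEmbedding) (R := R.map e.symm.toEmbedding) (X := X) (Y₁ := Y₁) (Y₂ := Y₂)
    (D := fun T => D (T.map e.toEmbedding))
    (fun u hu => hBW _ ((hpull _ _).1 hu)) (fun u hu => hRW _ ((hpull _ _).1 hu))
    (fun x y y' h1 h2 => (hpull _ _).2 (hB x y y' ((hpull _ _).1 h1) h2))
    (fun u hu => hB0 u ((hpull _ _).1 hu)) (Finset.map_subset_map.2 hAB)
    (hA.map_of_near hnear) ((hpull _ _).2 (hc ▸ hcA)) ((Finset.disjoint_map _).2 hAR)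
    (by rw [← hins, ← hc]; exact hR0.map_of_near hnear)
    (by rw [← hins]; exact hR1.map_of_near hnear)
    (by rw [← hins, hback]; exact hDR) hD' hDA' hX hY₁ hY₂ (fun u hu => hPW _ ((hP u).2 hu))
    (by rwa [← Finset.map_union, Finset.card_map])
  refine ⟨_, ?_, hDT⟩
  have := hT.map hrig
  rwa [Finset.map_union, hback, hback, Finset.card_map, Finset.card_map] at this

/-! ### Boxes -/

/-- The quadrant of the cells with non-negative coordinates. -/
def quadrant : Set Pt := {u | 0 ≤ u.1 ∧ 0 ≤ u.2}

theorem mem_quadrant {u : Pt} : u ∈ quadrant ↔ 0 ≤ u.1 ∧ 0 ≤ u.2 := Iff.rfl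

/-- The index of the interval that contains `x` when the non-negative integers are cut in front of
`o + m, o + 2 m, …`. The first interval absorbs the integers below `o`, so that for `0 ≤ o < m` no
interval is shorter than `m`. -/
def cutIdx (o m x : ℤ) : ℤ := max 0 ((x - o) / m)

/-- The first element of the interval that contains `x`. -/
def cutLo (o m x : ℤ) : ℤ := if cutIdx o m x = 0 then 0 else o + cutIdx o m x * m

/-- The last element of the interval that contains `x`. -/
def cutHi (o m x : ℤ) : ℤ := o + cutIdx o m x * m + m - 1

section Cut

variable {o m : ℤ}

theorem cutIdx_eq_iff (ho : 0 ≤ o) (hm : o < m) {x y : ℤ} :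
    0 ≤ y ∧ cutIdx o m y = cutIdx o m x ↔ cutLo o m x ≤ y ∧ y ≤ cutHi o m x := by
  have h0 : 0 ≤ cutIdx o m x := le_max_left _ _
  have hm0 : 0 < m := by omega
  unfold cutLo cutHi
  generalize cutIdx o m x = k at h0
  have key : cutIdx o m y = k ↔ (k = 0 ∨ o + k * m ≤ y) ∧ y ≤ o + k * m + m - 1 := by
    have h1 := Int.le_ediv_iff_mul_le (a := k) (b := y - o) hm0
    have h2 := Int.ediv_lt_iff_lt_mul (a := y - o) (b := k + 1) hm0
    rw [add_mul, one_mul] at h2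
    unfold cutIdx
    generalize k * m = q at *
    omega
  rw [key]
  split_ifs with h
  · simp [h]
  · have : m ≤ k * m := by nlinarith [show 1 ≤ k by omega]
    simp only [h, false_or]
    omega

theorem cut_self (ho : 0 ≤ o) (hm : o < m) {x : ℤ} (hx : 0 ≤ x) :
    cutLo o m x ≤ x ∧ x ≤ cutHi o m x :=
  (cutIdx_eq_iff ho hm).1 ⟨hx, rfl⟩

theorem cut_length (ho : 0 ≤ o) (hm : o < m) (x : ℤ) :
    m ≤ cutHi o m x - cutLo o m x + 1 ∧ cutHi o m x - cutLo o m x + 1 ≤ 2 * m := by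
  have h0 : 0 ≤ cutIdx o m x := le_max_left _ _
  unfold cutLo cutHi
  split_ifs with h
  · rw [h]; omega
  · omega

theorem cut_succ (ho : 0 ≤ o) (hm : o < m) {x : ℤ} (hx : 0 ≤ x)
    (h : cutIdx o m (x + 1) ≠ cutIdx o m x) : cutHi o m x = x ∧ cutLo o m (x + 1) = x + 1 := by
  have h1 := (cutIdx_eq_iff ho hm (x := x) (y := x + 1)).not.1 fun h' => h h'.2
  have h2 := (cutIdx_eq_iff ho hm (x := x + 1) (y := x)).not.1 fun h' => h h'.2.symm
  have h3 := cut_self ho hm hx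
  have h4 := cut_self ho hm (show 0 ≤ x + 1 by omega)
  omega

/-- The index of the box that contains a cell. -/
def boxIdx (o m : ℤ) (u : Pt) : Pt := (cutIdx o m u.1, cutIdx o m u.2)

/-- The box that contains a cell. -/
noncomputable def boxOf (o m : ℤ) (u : Pt) : Finset Pt :=
  Finset.Icc (cutLo o m u.1) (cutHi o m u.1) ×ˢ Finset.Icc (cutLo o m u.2) (cutHi o m u.2)

theorem mem_boxOf_iff {u v : Pt} : v ∈ boxOf o m u ↔
    (cutLo o m u.1 ≤ v.1 ∧ v.1 ≤ cutHi o m u.1) ∧ cutLo o m u.2 ≤ v.2 ∧ v.2 ≤ cutHi o m u.2 := by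
  simp [boxOf]

theorem mem_boxOf (ho : 0 ≤ o) (hm : o < m) {u v : Pt} :
    v ∈ boxOf o m u ↔ v ∈ quadrant ∧ boxIdx o m v = boxIdx o m u := by
  rw [mem_boxOf_iff, ← cutIdx_eq_iff ho hm, ← cutIdx_eq_iff ho hm, mem_quadrant, boxIdx, boxIdx,
    Prod.mk.injEq]
  tauto

theorem card_boxOf_le (ho : 0 ≤ o) {M : ℕ} (hm : o < M) (u : Pt) :
    (boxOf o M u).card ≤ 4 * M * M := by
  have h1 := (cut_length ho hm u.1).2
  have h2 := (cut_length ho hm u.2).2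
  rw [boxOf, Finset.card_product, Int.card_Icc, Int.card_Icc]
  calc _ ≤ (2 * M) * (2 * M) := Nat.mul_le_mul (by omega) (by omega)
    _ = _ := by ring

theorem pocket_capacity {m n X Y : ℤ} (hm : 1 ≤ m) (hn : n ≤ (m - 1) * m) (hX : m ≤ X)
    (hY : m ≤ Y) : n ≤ (X - 1) * Y :=
  hn.trans (mul_le_mul (by omega) hY (by omega) (by omega))

/-- Crossing from the box of the contact cell `c` into the box of the next cell `g` in
direction `d`. -/
theorem exists_cross_box {M : ℕ} (ho : 0 ≤ o) (hm : o < M) {A R : Finset Pt} {c d g : Pt}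
    {D : Finset Pt → Prop} (hd : IsDir d) (hgc : g = (c.1 + d.1, c.2 + d.2))
    (hg : g ∈ quadrant) (hbox : boxIdx o M g ≠ boxIdx o M c)
    (hW : ∀ u ∈ A ∪ R, u ∈ quadrant)
    (hA : Conn A) (hAc : ∀ a ∈ A, boxIdx o M a = boxIdx o M c) (hcA : c ∈ A)
    (hAR : Disjoint A R)
    (hR0 : Conn (insert c R)) (hR1 : Conn (insert g R)) (hDR : D (insert g R))
    (hD : ∀ T z t, D T → boxIdx o M z = boxIdx o M g → t ∈ T →
      boxIdx o M t = boxIdx o M g → Near t z → D (insert z T))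
    (hDA : ∀ A', (∀ a ∈ A', boxIdx o M a = boxIdx o M c) → Conn A' →
      (∃ a ∈ A', ∃ r ∈ R, boxIdx o M r = boxIdx o M c ∧ Near a r) → D (A' ∪ R))
    (hcap : ((A ∪ R).card : ℤ) ≤ ((M : ℤ) - 1) * M) :
    ∃ T, Tr quadrant (4 * M * M + 3 * A.card) (A ∪ R) T ∧ D T := by
  have hWA : ∀ u ∈ A, u ∈ quadrant := fun u hu => hW u (Finset.mem_union_left _ hu)
  have hcW := hWA c hcA
  have hB := card_boxOf_le ho hm c
  have hbox' := fun u v : Pt => mem_boxOf ho hm (u := u) (v := v)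
  suffices h : ∃ T, Tr quadrant ((boxOf o M c).card + 3 * A.card) (A ∪ R) T ∧ D T by
    obtain ⟨T, hT, hDT⟩ := h
    exact ⟨T, hT.mono (by omega), hDT⟩
  have hfg : frame c d (1, 0) = g := by rw [hgc]; simp [frame]
  obtain ⟨hc1, hc2⟩ := mem_quadrant.1 hcW
  obtain ⟨hg1, hg2⟩ := mem_quadrant.1 hg
  have s1 := cut_self ho hm hc1
  have s2 := cut_self ho hm hc2
  have s3 := cut_self ho hm hg1
  have s4 := cut_self ho hm hg2
  have l1 := cut_length ho hm c.1
  have l2 := cut_length ho hm c.2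
  have l3 := cut_length ho hm g.1
  have l4 := cut_length ho hm g.2
  have key : ∀ X Y₁ Y₂ : ℤ, (M : ℤ) ≤ X → Y₁ ≤ 0 → 0 ≤ Y₂ → (M : ℤ) ≤ Y₂ - Y₁ + 1 →
      (∀ x y y', frame c d (x, y) ∈ boxOf o M c → Toward y y' →
        frame c d (x, y') ∈ boxOf o M c) →
      (∀ u, frame c d u ∈ boxOf o M c → u.1 ≤ 0) →
      (∀ u, frame c d u ∈ boxOf o M g ↔ u ∈ pocket X Y₁ Y₂) →
      ∃ T, Tr quadrant ((boxOf o M c).card + 3 * A.card) (A ∪ R) T ∧ D T := by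
    intro X Y₁ Y₂ hX hY₁ hY₂ hY h1 h2 h3
    refine exists_cross hd (fun u hu => ((hbox' _ _).1 hu).1)
      (fun u hu => hW u (Finset.mem_union_right _ hu)) h1 h2 h3
      (fun u hu => (hbox' _ _).2 ⟨hWA u hu, hAc u hu⟩) hA hcA hAR hR0 (hfg ▸ hR1) (hfg ▸ hDR)
      (fun T z t h4 h5 h6 h7 h8 => hD T z t h4 ((hbox' _ _).1 h5).2 h6 ((hbox' _ _).1 h7).2 h8)
      (fun A' h4 h5 => ?_) (by omega) hY₁ hY₂ (fun u hu => ((hbox' _ _).1 hu).1)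
      (pocket_capacity (by omega) hcap hX hY)
    rintro ⟨a, ha, r, hr, hrB, h6⟩
    exact hDA A' (fun a ha => ((hbox' _ _).1 (h4 ha)).2) h5
      ⟨a, ha, r, hr, ((hbox' _ _).1 hrB).2, h6⟩
  simp only [mem_boxOf_iff, mem_pocket, frame, Toward] at key
  rcases hd with rfl | rfl | rfl | rfl <;> simp only [add_zero] at hgc <;> subst hgc <;>
    simp only [boxIdx, ne_eq, Prod.mk.injEq, and_true, true_and] at hbox <;>
    simp only at s3 s4 l3 l4 key hg1 hg2
  · have := cut_succ ho hm hc1 hbox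
    refine key (cutHi o M (c.1 + 1) - c.1) (cutLo o M c.2 - c.2) (cutHi o M c.2 - c.2) ?_ ?_ ?_ ?_
      ?_ ?_ ?_ <;> intros <;> omega
  · have := cut_succ ho hm hg1 (by rw [neg_add_cancel_right]; exact fun h => hbox h.symm)
    rw [neg_add_cancel_right] at this
    refine key (c.1 - cutLo o M (c.1 + -1)) (c.2 - cutHi o M c.2) (c.2 - cutLo o M c.2) ?_ ?_ ?_ ?_
      ?_ ?_ ?_ <;> intros <;> omega
  · have := cut_succ ho hm hc2 hbox
    refine key (cutHi o M (c.2 + 1) - c.2) (c.1 - cutHi o M c.1) (c.1 - cutLo o M c.1) ?_ ?_ ?_ ?_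
      ?_ ?_ ?_ <;> intros <;> omega
  · have := cut_succ ho hm hg2 (by rw [neg_add_cancel_right]; exact fun h => hbox h.symm)
    rw [neg_add_cancel_right] at this
    refine key (c.2 - cutLo o M (c.2 + -1)) (cutLo o M c.1 - c.1) (cutHi o M c.1 - c.1) ?_ ?_ ?_ ?_
      ?_ ?_ ?_ <;> intros <;> omega

end Cut

/-! ### Shapes assembled from pieces -/

/-- A connected set of cells of a single box whose index belongs to `I`. -/
def IsPiece (o m : ℤ) (I : Set Pt) (X : Finset Pt) : Prop :=
  Conn X ∧ ∃ i ∈ I, ∀ x ∈ X, boxIdx o m x = i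

/-- `Built o m I k T`: the set `T` arises from one piece by attaching `k` further pieces one after
the other, each near a cell that is already present. Several pieces may lie in the same box. -/
def Built (o m : ℤ) (I : Set Pt) : ℕ → Finset Pt → Prop
  | 0, T => IsPiece o m I T
  | k + 1, T => ∃ R X, Built o m I k R ∧ IsPiece o m I X ∧ (∃ r ∈ R, ∃ x ∈ X, Near r x) ∧
      T = R ∪ X

section Built

variable {o m : ℤ} {I : Set Pt} {k : ℕ} {T R X : Finset Pt}

theorem Built.conn (h : Built o m I k T) : Conn T := by
  induction k generalizing T with
  | zero => exact h.1
  | succ k ih =>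
    obtain ⟨R, X, hR, hX, ⟨r, hr, x, hx, hn⟩, rfl⟩ := h
    exact (ih hR).union_of_near hX.1 hr hx hn

/-- A connected set that lies in the box of one of its neighbours in `R` costs no new piece. -/
theorem Built.union (h : Built o m I k R) (hX : Conn X) {r x : Pt} (hr : r ∈ R) (hx : x ∈ X)
    (hn : Near r x) (hbox : ∀ y ∈ X, boxIdx o m y = boxIdx o m r) : Built o m I k (R ∪ X) := by
  have piece : ∀ Y, IsPiece o m I Y → r ∈ Y → IsPiece o m I (Y ∪ X) := by
    rintro Y ⟨hY, i, hi, hYi⟩ hrY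
    refine ⟨hY.union_of_near hX hrY hx hn, i, hi, fun y hy => ?_⟩
    rcases Finset.mem_union.1 hy with hy | hy
    · exact hYi y hy
    · rw [hbox y hy, hYi r hrY]
  induction k generalizing R with
  | zero => exact piece R h hr
  | succ k ih =>
    obtain ⟨R', Y, hR', hY, ⟨r', hr', y, hy, hn'⟩, rfl⟩ := h
    rcases Finset.mem_union.1 hr with hr | hr
    · exact ⟨R' ∪ X, Y, ih hR' hr, hY, ⟨r', Finset.mem_union_left _ hr', y, hy, hn'⟩,
        Finset.union_right_comm _ _ _⟩
    · exact ⟨R', Y ∪ X, hR', piece Y hY hr, ⟨r', hr', y, Finset.mem_union_left _ hy, hn'⟩,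
        Finset.union_assoc _ _ _⟩

theorem Built.insert (h : Built o m I k R) {r z : Pt} (hr : r ∈ R) (hn : Near r z)
    (hbox : boxIdx o m z = boxIdx o m r) : Built o m I k (insert z R) := by
  rw [Finset.insert_eq, Finset.union_comm]
  exact h.union (Conn.singleton z) hr (Finset.mem_singleton_self z) hn
    fun y hy => by rw [Finset.mem_singleton.1 hy, hbox]

variable {M : ℕ} {A : Finset Pt} {c g p d : Pt}

/-- If the cell `g` next to the contact cell `c` of `A`, in an axis direction, lies in the box of
a cell `p` of the rest `R`, then `A` is absorbed by the pieces of `R` at linear cost. -/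
theorem Built.absorb_straight (ho : 0 ≤ o) (hm : o < M) (hR : Built o M I k R) (hA : Conn A)
    (hAc : ∀ a ∈ A, boxIdx o M a = boxIdx o M c) (hcA : c ∈ A) (hpR : p ∈ R) (hcp : Near p c)
    (hd : IsDir d) (hgc : g = (c.1 + d.1, c.2 + d.2)) (hg : g ∈ quadrant)
    (hbox : boxIdx o M g ≠ boxIdx o M c) (hgp : Near p g) (hpg : boxIdx o M p = boxIdx o M g)
    (hW : ∀ u ∈ A ∪ R, u ∈ quadrant) (hcap : ((A ∪ R).card : ℤ) ≤ ((M : ℤ) - 1) * M) :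
    ∃ T, Tr quadrant (4 * M * M + 3 * A.card) (A ∪ R) T ∧ Built o M I k T := by
  have merge : ∀ A', (∀ a ∈ A', boxIdx o M a = boxIdx o M c) → Conn A' →
      (∃ a ∈ A', ∃ r ∈ R, boxIdx o M r = boxIdx o M c ∧ Near a r) →
      Built o M I k (A' ∪ R) := by
    rintro A' h1 h2 ⟨a, ha, r, hr, hrc, h3⟩
    rw [Finset.union_comm]
    exact hR.union h2 hr ha h3.symm fun y hy => by rw [h1 y hy, hrc]
  by_cases hmeet : ∃ a ∈ A, ∃ r ∈ R, boxIdx o M r = boxIdx o M c ∧ Near a r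
  · exact ⟨_, Tr.refl _ (merge A hAc hA hmeet).conn hW, merge A hAc hA hmeet⟩
  have hAR : Disjoint A R := by
    rw [Finset.disjoint_left]
    exact fun a ha hr => hmeet ⟨a, ha, a, hr, hAc a ha, Near.refl a⟩
  exact exists_cross_box ho hm (D := Built o M I k) hd hgc hg hbox hW hA hAc hcA hAR
    (hR.conn.insert_of_near hpR hcp) (hR.conn.insert_of_near hpR hgp)
    (hR.insert hpR hgp hpg.symm)
    (fun T z t h1 h2 h3 h4 h5 => h1.insert h3 h5 (h2.trans h4.symm)) merge hcap

/-- The last piece of a shape is absorbed by the other pieces at linear cost. If the contact to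
the rest is diagonal across a corner of the boxes, the piece is first brought into the
box next to the corner, from where the contact is straight. -/
theorem Built.reduce (ho : 0 ≤ o) (hm : o < M) (hT : Built o M I (k + 1) T)
    (hW : ∀ u ∈ T, u ∈ quadrant) (hcap : (T.card : ℤ) ≤ ((M : ℤ) - 1) * M) :
    ∃ T', Tr quadrant (8 * M * M + 6 * T.card) T T' ∧ Built o M I k T' := by
  obtain ⟨R, A, hR, ⟨hA, i, hi, hAi⟩, ⟨p, hpR, c, hcA, hn⟩, rfl⟩ := hT
  rw [Finset.union_comm] at hcap hW ⊢
  have hAc : ∀ a ∈ A, boxIdx o M a = boxIdx o M c := fun a ha => by rw [hAi a ha, hAi c hcA]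
  have hle : A.card ≤ (A ∪ R).card := Finset.card_le_card Finset.subset_union_left
  have hc := mem_quadrant.1 (hW c (Finset.mem_union_left _ hcA))
  have hp := mem_quadrant.1 (hW p (Finset.mem_union_right _ hpR))
  have merge : ∀ A', (∀ a ∈ A', boxIdx o M a = boxIdx o M c) → Conn A' →
      (∃ a ∈ A', ∃ r ∈ R, boxIdx o M r = boxIdx o M c ∧ Near a r) →
      Built o M I k (A' ∪ R) := by
    rintro A' h1 h2 ⟨a, ha, r, hr, hrc, h3⟩
    rw [Finset.union_comm]
    exact hR.union h2 hr ha h3.symm fun y hy => by rw [h1 y hy, hrc]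
  by_cases hmeet : ∃ a ∈ A, ∃ r ∈ R, boxIdx o M r = boxIdx o M c ∧ Near a r
  · exact ⟨_, Tr.refl _ (merge A hAc hA hmeet).conn hW, merge A hAc hA hmeet⟩
  have hne : boxIdx o M p ≠ boxIdx o M c := fun h => hmeet ⟨c, hcA, p, hpR, h, hn.symm⟩
  have hn' := hn
  unfold Near at hn'
  by_cases h1 : cutIdx o M p.1 = cutIdx o M c.1
  · -- the boxes differ in the second coordinate only
    have h2 : cutIdx o M p.2 ≠ cutIdx o M c.2 := fun h => hne (Prod.ext h1 h)
    have h3 : p.2 ≠ c.2 := fun h => h2 (by rw [h])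
    have hdir : IsDir (0, p.2 - c.2) := by
      have : p.2 - c.2 = 1 ∨ p.2 - c.2 = -1 := by omega
      rcases this with h | h <;> rw [h] <;> simp [IsDir]
    obtain ⟨T', hT', hB⟩ := hR.absorb_straight ho hm hA hAc hcA hpR hn hdir (g := (c.1, p.2))
      (by simp) (mem_quadrant.2 ⟨hc.1, hp.2⟩) (fun h => h2 (Prod.mk.inj h).2)
      (by simp only [Near]; omega) (Prod.ext h1 rfl) hW hcap
    exact ⟨T', hT'.mono (by nlinarith), hB⟩
  · have h3 : p.1 ≠ c.1 := fun h => h1 (by rw [h])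
    have hdir : IsDir (p.1 - c.1, 0) := by
      have : p.1 - c.1 = 1 ∨ p.1 - c.1 = -1 := by omega
      rcases this with h | h <;> rw [h] <;> simp [IsDir]
    have hgq : (p.1, c.2) ∈ quadrant := mem_quadrant.2 ⟨hp.1, hc.2⟩
    have hgc : (p.1, c.2) = (c.1 + (p.1 - c.1), c.2 + 0) := by simp
    have hgb : boxIdx o M (p.1, c.2) ≠ boxIdx o M c := fun h => h1 (Prod.mk.inj h).1
    have hpg : Near p (p.1, c.2) := by simp only [Near]; omega
    by_cases h2 : cutIdx o M p.2 = cutIdx o M c.2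
    · obtain ⟨T', hT', hB⟩ := hR.absorb_straight ho hm hA hAc hcA hpR hn hdir hgc hgq hgb hpg
        (Prod.ext rfl h2) hW hcap
      exact ⟨T', hT'.mono (by nlinarith), hB⟩
    · have hAR : Disjoint A R := by
        rw [Finset.disjoint_left]
        exact fun a ha hr => hmeet ⟨a, ha, a, hr, hAc a ha, Near.refl a⟩
      -- After the first crossing the piece either has merged with others or is a connected
      -- set `Z` which contains the cell between `c` and `p`.
      have hclosed : ∀ T z t, (Built o M I k T ∨ ∃ Z R', Built o M I k R' ∧ Conn Z ∧
          (∀ z ∈ Z, boxIdx o M z = boxIdx o M (p.1, c.2)) ∧ (p.1, c.2) ∈ Z ∧ p ∈ R' ∧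
          T = Z ∪ R') → boxIdx o M z = boxIdx o M (p.1, c.2) → t ∈ T →
          boxIdx o M t = boxIdx o M (p.1, c.2) → Near t z →
          (Built o M I k (Insert.insert z T) ∨ ∃ Z R', Built o M I k R' ∧ Conn Z ∧
          (∀ z ∈ Z, boxIdx o M z = boxIdx o M (p.1, c.2)) ∧ (p.1, c.2) ∈ Z ∧ p ∈ R' ∧
          Insert.insert z T = Z ∪ R') := by
        rintro T z t (h4 | ⟨Z, R', hR', hZ, hZg, hgZ, hpR', rfl⟩) h5 h6 h7 h8
        · exact Or.inl (h4.insert h6 h8 (h5.trans h7.symm))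
        · right
          rcases Finset.mem_union.1 h6 with h6 | h6
          · refine ⟨Insert.insert z Z, R', hR', hZ.insert_of_near h6 h8, ?_,
              Finset.mem_insert_of_mem hgZ, hpR', (Finset.insert_union _ _ _).symm⟩
            intro y hy
            rcases Finset.mem_insert.1 hy with rfl | hy
            · exact h5
            · exact hZg y hy
          · exact ⟨Z, Insert.insert z R', hR'.insert h6 h8 (h5.trans h7.symm), hZ, hZg, hgZ,
              Finset.mem_insert_of_mem hpR', (Finset.union_insert _ _ _).symm⟩
      obtain ⟨T₁, hT₁, hD⟩ := exists_cross_box ho hm hdir hgc hgq hgb hW hA hAc hcA hAR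
        (hR.conn.insert_of_near hpR hn) (hR.conn.insert_of_near hpR hpg)
        (Or.inr ⟨{(p.1, c.2)}, R, hR, Conn.singleton _, by simp, by simp, hpR,
          by rw [Finset.insert_eq]⟩) hclosed
        (fun A' h4 h5 h6 => Or.inl (merge A' h4 h5 h6)) hcap
      have hcard := hT₁.card_eq
      rcases hD with hB | ⟨Z, R', hR', hZ, hZg, hgZ, hpR', rfl⟩
      · exact ⟨T₁, hT₁.mono (by nlinarith), hB⟩
      · have h4 : p.2 ≠ c.2 := fun h => h2 (by rw [h])
        have hdir' : IsDir (0, p.2 - c.2) := by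
          have : p.2 - c.2 = 1 ∨ p.2 - c.2 = -1 := by omega
          rcases this with h | h <;> rw [h] <;> simp [IsDir]
        obtain ⟨T', hT', hB⟩ := hR'.absorb_straight ho hm hZ hZg hgZ hpR' hpg hdir' (g := p)
          (by simp) (mem_quadrant.2 hp) (fun h => h2 (Prod.mk.inj h).2) (Near.refl p) rfl
          hT₁.subset_right (by rwa [hcard])
        have hle' : Z.card ≤ (Z ∪ R').card := Finset.card_le_card Finset.subset_union_left
        exact ⟨T', (hT₁.trans hT').mono (by nlinarith), hB⟩

/-- All pieces are absorbed, one after the other, until the shape lies in a single box. -/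
theorem Built.collapse (ho : 0 ≤ o) (hm : o < M) (hT : Built o M I k T)
    (hW : ∀ u ∈ T, u ∈ quadrant) (hcap : (T.card : ℤ) ≤ ((M : ℤ) - 1) * M) :
    ∃ T', Tr quadrant (k * (8 * M * M + 6 * T.card)) T T' ∧ IsPiece o M I T' := by
  induction k generalizing T with
  | zero => exact ⟨T, Tr.refl _ hT.conn hW, hT⟩
  | succ k ih =>
    obtain ⟨T₁, hT₁, hB⟩ := hT.reduce ho hm hW hcap
    have hcard := hT₁.card_eq
    obtain ⟨T', hT', hP⟩ := ih hB hT₁.subset_right (by rwa [hcard])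
    rw [hcard] at hT'
    exact ⟨T', (hT₁.trans hT').mono (by rw [add_mul, one_mul]; omega), hP⟩

end Built

/-! ### The number of pieces -/

open Classical in
/-- The cells of `S` that are near a cell of `S` in another box. -/
noncomputable def contactCells (o m : ℤ) (S : Finset Pt) : Finset Pt :=
  S.filter fun z => ∃ t ∈ S, Near t z ∧ boxIdx o m t ≠ boxIdx o m z

/-- A connected shape is assembled cell by cell; a new piece is needed only for a cell with a
neighbour in another box. -/
theorem exists_built (o m : ℤ) {S : Finset Pt} (hS : Conn S) :
    ∃ k ≤ (contactCells o m S).card, Built o m (boxIdx o m '' S) k S := by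
  classical
  have key : ∀ j, j < S.card → ∃ T ⊆ S, T.card = j + 1 ∧
      ∃ k ≤ (contactCells o m S ∩ T).card, Built o m (boxIdx o m '' S) k T := by
    intro j
    induction j with
    | zero =>
      intro _
      obtain ⟨s, hs⟩ := hS.1
      exact ⟨{s}, by simpa using hs, by simp, 0, Nat.zero_le _, Conn.singleton s, _, ⟨s, hs, rfl⟩,
        by simp⟩
    | succ j ih =>
      intro hj
      obtain ⟨T, hTS, hTc, k, hk, hB⟩ := ih (by omega)
      obtain ⟨t, ht, z, hzS, hzT, hn⟩ : ∃ t ∈ T, ∃ z ∈ S, z ∉ T ∧ Near t z := by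
        by_contra hcon
        push Not at hcon
        obtain ⟨t, ht⟩ := hB.conn.1
        have hall : ∀ v, Link S t v → v ∈ T := by
          intro v h
          induction h with
          | refl => exact ht
          | @tail b c _ h ih =>
            by_contra hc
            exact hcon b ih c h.2.1 hc h.2.2
        have : S ⊆ T := fun v hv => hall v (hS.2 t (hTS ht) v hv)
        have := Finset.card_le_card this
        omega
      refine ⟨insert z T, Finset.insert_subset hzS hTS, by
        rw [Finset.card_insert_of_notMem hzT, hTc], ?_⟩
      by_cases hbox : boxIdx o m t = boxIdx o m z
      · exact ⟨k, hk.trans (Finset.card_le_card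
          (Finset.inter_subset_inter_left (Finset.subset_insert _ _))), hB.insert ht hn hbox.symm⟩
      · refine ⟨k + 1, ?_, T, {z}, hB, ⟨Conn.singleton z, _, ⟨z, hzS, rfl⟩, by simp⟩,
          ⟨t, ht, z, Finset.mem_singleton_self z, hn⟩, ?_⟩
        · have hz : z ∈ contactCells o m S := Finset.mem_filter.2 ⟨hzS, t, hTS ht, hn, hbox⟩
          rw [Finset.inter_insert_of_mem hz, Finset.card_insert_of_notMem fun h =>
            hzT (Finset.mem_inter.1 h).2]
          omega
        · rw [Finset.insert_eq, Finset.union_comm]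
  have hpos := Finset.card_pos.2 hS.1
  obtain ⟨T, hTS, hTc, k, hk, hB⟩ := key (S.card - 1) (by omega)
  obtain rfl : T = S := Finset.eq_of_subset_of_card_le hTS (by omega)
  exact ⟨k, hk.trans (Finset.card_le_card Finset.inter_subset_left), hB⟩

theorem dvd_of_cutIdx_succ_ne {o m : ℤ} (ho : 0 ≤ o) (hm : o < m) {x : ℤ}
    (h : cutIdx o m (x + 1) ≠ cutIdx o m x) : m ∣ x + 1 - o := by
  have hm0 : 0 < m := by omega
  have h1 : (x - o) / m < (x + 1 - o) / m := by
    refine lt_of_le_of_ne (Int.ediv_le_ediv hm0 (by omega)) fun h' => h ?_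
    rw [cutIdx, cutIdx, h']
  have h2 := Int.mul_ediv_add_emod (x + 1 - o) m
  have h3 := Int.emod_nonneg (x + 1 - o) hm0.ne'
  have h4 := (Int.ediv_lt_iff_lt_mul hm0).1 h1
  rw [mul_comm] at h4
  exact ⟨(x + 1 - o) / m, by omega⟩

/-- Some offset of the boxes leaves few cells of `S` next to a box boundary. Every cell is next to
a vertical boundary for at most two of the `M` offsets, and likewise for horizontal ones. -/
theorem exists_offset {M : ℕ} (hM : 1 ≤ M) (S : Finset Pt) :
    ∃ o : ℤ, 0 ≤ o ∧ o < M ∧ M * (contactCells o M S).card ≤ 4 * S.card := by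
  classical
  have hmem : ∀ o ∈ Finset.Ico (0 : ℤ) M, ∀ z ∈ contactCells o M S,
      o ∈ ({z.1 % M, (z.1 + 1) % M, z.2 % M, (z.2 + 1) % M} : Finset ℤ) := by
    intro o ho z hz
    rw [Finset.mem_Ico] at ho
    obtain ⟨-, t, -, hn, hne⟩ := Finset.mem_filter.1 hz
    have hmod : ∀ x : ℤ, (M : ℤ) ∣ x - o → o = x % M := fun x hx => by
      have : o % M = x % M := Int.modEq_iff_dvd.2 hx
      rwa [Int.emod_eq_of_lt ho.1 ho.2] at this
    have hcut : ∀ x y : ℤ, x ≤ y + 1 → y ≤ x + 1 → cutIdx o M x ≠ cutIdx o M y →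
        o = y % M ∨ o = (y + 1) % M := by
      intro x y h1 h2 h3
      have h4 : x ≠ y := fun h => h3 (by rw [h])
      obtain rfl | rfl : y = x + 1 ∨ x = y + 1 := by omega
      · exact Or.inl (hmod _ (dvd_of_cutIdx_succ_ne ho.1 ho.2 h3.symm))
      · exact Or.inr (hmod _ (dvd_of_cutIdx_succ_ne ho.1 ho.2 h3))
    simp only [Finset.mem_insert, Finset.mem_singleton]
    by_cases h1 : cutIdx o M t.1 = cutIdx o M z.1
    · have := hcut _ _ hn.2.2.1 hn.2.2.2 fun h2 => hne (Prod.ext h1 h2)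
      tauto
    · have := hcut _ _ hn.1 hn.2.1 h1
      tauto
  have hsum : ∑ o ∈ Finset.Ico (0 : ℤ) M, (contactCells o M S).card ≤ S.card * 4 := by
    have h1 : ∀ o : ℤ, contactCells o M S =
        Finset.bipartiteAbove (fun o z => z ∈ contactCells o M S) S o := by
      intro o
      ext z
      rw [Finset.mem_bipartiteAbove]
      exact ⟨fun h => ⟨(Finset.mem_filter.1 h).1, h⟩, fun h => h.2⟩
    calc _ = ∑ o ∈ Finset.Ico (0 : ℤ) M,
          (Finset.bipartiteAbove (fun o z => z ∈ contactCells o M S) S o).card :=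
          Finset.sum_congr rfl fun o _ => by rw [← h1]
      _ = _ := Finset.sum_card_bipartiteAbove_eq_sum_card_bipartiteBelow _
      _ ≤ _ := by
        refine Finset.sum_le_card_nsmul _ _ 4 fun z _ => ?_
        refine (Finset.card_le_card fun o ho => ?_).trans
          (Finset.card_le_four (a := z.1 % M) (b := (z.1 + 1) % M) (c := z.2 % M)
            (d := (z.2 + 1) % M))
        rw [Finset.mem_bipartiteBelow] at ho
        exact hmem o ho.1 z ho.2
  obtain ⟨o, ho, h⟩ := Finset.exists_le_of_sum_le (s := Finset.Ico (0 : ℤ) M)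
    (f := fun o => M * (contactCells o M S).card) (g := fun _ => 4 * S.card)
    ⟨0, by rw [Finset.mem_Ico]; omega⟩ (by
      rw [← Finset.mul_sum, Finset.sum_const, Int.card_Ico, smul_eq_mul, sub_zero, Int.toNat_natCast]
      exact Nat.mul_le_mul_left _ (by omega))
  rw [Finset.mem_Ico] at ho
  exact ⟨o, ho.1, ho.2, h⟩

/-! ### Straight lines -/

theorem Conn.fst_extent {T : Finset Pt} (hT : Conn T) {u v : Pt} (hu : u ∈ T) (hv : v ∈ T) :
    v.1 - u.1 + 1 ≤ T.card := by
  have h : Finset.Icc u.1 v.1 ⊆ T.image Prod.fst := fun x hx => by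
    rw [Finset.mem_Icc] at hx
    obtain ⟨w, hw, rfl⟩ := hT.exists_fst_eq hu hv hx.1 hx.2
    exact Finset.mem_image_of_mem _ hw
  have := (Finset.card_le_card h).trans Finset.card_image_le
  rw [Int.card_Icc] at this
  omega

theorem Conn.snd_extent {T : Finset Pt} (hT : Conn T) {u v : Pt} (hu : u ∈ T) (hv : v ∈ T) :
    v.2 - u.2 + 1 ≤ T.card := by
  have h : Finset.Icc u.2 v.2 ⊆ T.image Prod.snd := fun x hx => by
    rw [Finset.mem_Icc] at hx
    obtain ⟨w, hw, rfl⟩ := hT.exists_snd_eq hu hv hx.1 hx.2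
    exact Finset.mem_image_of_mem _ hw
  have := (Finset.card_le_card h).trans Finset.card_image_le
  rw [Int.card_Icc] at this
  omega

/-- The horizontal line of `n` cells with left end `(x, y)`. -/
noncomputable def zRow (x y : ℤ) (n : ℕ) : Finset Pt :=
  Finset.Icc x (x + n - 1) ×ˢ Finset.Icc y y

/-- The vertical line of `n` cells with lower end `(x, y)`. -/
noncomputable def zCol (x y : ℤ) (n : ℕ) : Finset Pt :=
  Finset.Icc x x ×ˢ Finset.Icc y (y + n - 1)

theorem mem_zRow {x y : ℤ} {n : ℕ} {u : Pt} :
    u ∈ zRow x y n ↔ (x ≤ u.1 ∧ u.1 ≤ x + n - 1) ∧ y ≤ u.2 ∧ u.2 ≤ y := by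
  simp only [zRow, Finset.mem_product, Finset.mem_Icc]

theorem mem_zCol {x y : ℤ} {n : ℕ} {u : Pt} :
    u ∈ zCol x y n ↔ (x ≤ u.1 ∧ u.1 ≤ x) ∧ y ≤ u.2 ∧ u.2 ≤ y + n - 1 := by
  simp only [zCol, Finset.mem_product, Finset.mem_Icc]

theorem card_zRow (x y : ℤ) (n : ℕ) : (zRow x y n).card = n := by
  rw [zRow, Finset.card_product, Int.card_Icc, Int.card_Icc,
    show (y + 1 - y).toNat = 1 by omega, mul_one]
  omega

theorem card_zCol (x y : ℤ) (n : ℕ) : (zCol x y n).card = n := by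
  rw [zCol, Finset.card_product, Int.card_Icc, Int.card_Icc,
    show (x + 1 - x).toNat = 1 by omega, one_mul]
  omega

theorem zRow_conn (x y : ℤ) {n : ℕ} (hn : 1 ≤ n) : Conn (zRow x y n) := by
  refine Conn.of_center (w := (x, y)) (mem_zRow.2 (by simp only; omega)) ?_
  rintro ⟨a, b⟩ hu
  have := mem_zRow.1 hu
  simp only at this
  obtain rfl : b = y := by omega
  exact link_row_of_le this.1.1 fun i _ _ => mem_zRow.2 (by simp only; omega)

theorem zCol_conn (x y : ℤ) {n : ℕ} (hn : 1 ≤ n) : Conn (zCol x y n) := by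
  refine Conn.of_center (w := (x, y)) (mem_zCol.2 (by simp only; omega)) ?_
  rintro ⟨a, b⟩ hu
  have := mem_zCol.1 hu
  simp only at this
  obtain rfl : a = x := by omega
  exact link_col_of_le this.2.1 fun i _ _ => mem_zCol.2 (by simp only; omega)

theorem Conn.eq_zRow {T : Finset Pt} (hT : Conn T) {x y : ℤ} (h : (x, y) ∈ T)
    (hall : ∀ u ∈ T, u.2 = y ∧ x ≤ u.1) : T = zRow x y T.card := by
  refine Finset.eq_of_subset_of_card_le (fun u hu => mem_zRow.2 ?_) (by rw [card_zRow])
  have h1 := hall u hu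
  have h2 := hT.fst_extent h hu
  simp only at h2
  omega

theorem Conn.eq_zCol {T : Finset Pt} (hT : Conn T) {x y : ℤ} (h : (x, y) ∈ T)
    (hall : ∀ u ∈ T, u.1 = x ∧ y ≤ u.2) : T = zCol x y T.card := by
  refine Finset.eq_of_subset_of_card_le (fun u hu => mem_zCol.2 ?_) (by rw [card_zCol])
  have h1 := hall u hu
  have h2 := hT.snd_extent h hu
  simp only at h2
  omega

theorem tr_zRow {x x' y : ℤ} {n : ℕ} (hn : 1 ≤ n) (hx : 0 ≤ x) (hx' : 0 ≤ x') (hy : 0 ≤ y) :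
    Tr quadrant (x' - x).natAbs (zRow x y n) (zRow x' y n) := by
  have hW : ∀ x, 0 ≤ x → ∀ u ∈ zRow x y n, u ∈ quadrant := fun x hx u hu => by
    have := mem_zRow.1 hu
    exact mem_quadrant.2 (by omega)
  have right : ∀ k : ℕ, ∀ x, 0 ≤ x → Tr quadrant k (zRow x y n) (zRow (x + k) y n) := by
    intro k x hx
    induction k with
    | zero => simpa using Tr.refl _ (zRow_conn x y hn) (hW x hx)
    | succ k ih =>
      refine ih.tail (Or.inl ⟨x + k, x + k + n, y, by omega, fun i hi => mem_zRow.2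
        (by simp only; omega), fun h => ?_, ?_⟩) (zRow_conn _ _ hn) (hW _ (by omega))
      · have := mem_zRow.1 h; simp only at this; omega
      · ext ⟨a, b⟩
        simp only [Finset.mem_insert, Finset.mem_erase, mem_zRow, ne_eq, Prod.mk.injEq]
        push_cast
        omega
  rcases le_total x x' with h | h
  · have := right (x' - x).natAbs x hx
    rwa [show x + ((x' - x).natAbs : ℤ) = x' by omega] at this
  · have := (right (x' - x).natAbs x' hx').symm
    rwa [show x' + ((x' - x).natAbs : ℤ) = x by omega] at this

theorem tr_zCol {x y y' : ℤ} {n : ℕ} (hn : 1 ≤ n) (hx : 0 ≤ x) (hy : 0 ≤ y) (hy' : 0 ≤ y') :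
    Tr quadrant (y' - y).natAbs (zCol x y n) (zCol x y' n) := by
  have hW : ∀ y, 0 ≤ y → ∀ u ∈ zCol x y n, u ∈ quadrant := fun y hy u hu => by
    have := mem_zCol.1 hu
    exact mem_quadrant.2 (by omega)
  have up : ∀ k : ℕ, ∀ y, 0 ≤ y → Tr quadrant k (zCol x y n) (zCol x (y + k) n) := by
    intro k y hy
    induction k with
    | zero => simpa using Tr.refl _ (zCol_conn x y hn) (hW y hy)
    | succ k ih =>
      refine ih.tail (Or.inr ⟨x, y + k, y + k + n, by omega, fun i hi => mem_zCol.2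
        (by simp only; omega), fun h => ?_, ?_⟩) (zCol_conn _ _ hn) (hW _ (by omega))
      · have := mem_zCol.1 h; simp only at this; omega
      · ext ⟨a, b⟩
        simp only [Finset.mem_insert, Finset.mem_erase, mem_zCol, ne_eq, Prod.mk.injEq]
        push_cast
        omega
  rcases le_total y y' with h | h
  · have := up (y' - y).natAbs y hy
    rwa [show y + ((y' - y).natAbs : ℤ) = y' by omega] at this
  · have := (up (y' - y).natAbs y' hy').symm
    rwa [show y' + ((y' - y).natAbs : ℤ) = y by omega] at this

/-- A connected shape in `B` is pushed out, cell by cell, into the line that starts next to its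
cell `c` in direction `d`: the crossing with no other nodes, and with a line as its pocket. -/
theorem exists_tr_line {A B : Finset Pt} {c d : Pt} (hd : IsDir d)
    (hBW : ∀ u ∈ B, u ∈ quadrant)
    (hB : ∀ x y y', frame c d (x, y) ∈ B → Toward y y' → frame c d (x, y') ∈ B)
    (hB0 : ∀ u, frame c d u ∈ B → u.1 ≤ 0) (hAB : A ⊆ B) (hA : Conn A) (hcA : c ∈ A)
    (hPW : ∀ x, 1 ≤ x → frame c d (x, 0) ∈ quadrant) :
    ∃ T, Tr quadrant (B.card + 3 * A.card) A T ∧ frame c d (1, 0) ∈ T ∧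
      ∀ u ∈ T, ∃ x, 1 ≤ x ∧ u = frame c d (x, 0) := by
  have hP : ∀ u, frame c d u ∈ (pocket (A.card + 1) 0 0).map (frameEquiv c d hd).toEmbedding ↔
      u ∈ pocket (A.card + 1) 0 0 := fun u => Finset.mem_map' (frameEquiv c d hd).toEmbedding
  have hP' : ∀ u ∈ (pocket (A.card + 1) 0 0).map (frameEquiv c d hd).toEmbedding,
      ∃ x, 1 ≤ x ∧ u = frame c d (x, 0) := by
    intro u hu
    obtain ⟨⟨x, y⟩, hv, rfl⟩ := Finset.mem_map.1 hu
    have := mem_pocket.1 hv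
    simp only at this
    obtain rfl : y = 0 := by omega
    exact ⟨x, this.1.1, rfl⟩
  obtain ⟨T, hT, hgT, hDT⟩ := exists_cross (W := quadrant) (R := ∅)
    (D := fun T => frame c d (1, 0) ∈ T ∧ ∀ u ∈ T, ∃ x, 1 ≤ x ∧ u = frame c d (x, 0))
    hd hBW (by simp) hB hB0 hP hAB hA hcA (Finset.disjoint_empty_right _)
    (Conn.singleton c) (Conn.singleton _) (by
      refine ⟨Finset.mem_insert_self _ _, fun u hu => ⟨1, le_rfl, ?_⟩⟩
      simpa using hu)
    (fun T z t h1 h2 _ _ _ => by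
      refine ⟨Finset.mem_insert_of_mem h1.1, fun u hu => ?_⟩
      rcases Finset.mem_insert.1 hu with rfl | hu
      · exact hP' _ h2
      · exact h1.2 u hu)
    (fun A' _ _ h => by obtain ⟨a, _, r, hr, _⟩ := h; simp at hr)
    (by omega) le_rfl le_rfl
    (fun u hu => by obtain ⟨x, hx, rfl⟩ := hP' u hu; exact hPW x hx)
    (by rw [Finset.union_empty]; omega)
  rw [Finset.union_empty] at hT
  exact ⟨T, hT, hgT, hDT⟩

/-- A horizontal line turns into a vertical one that starts above its left end. -/
theorem tr_zRow_zCol {x y : ℤ} {n : ℕ} (hn : 1 ≤ n) (hx : 0 ≤ x) (hy : 0 ≤ y) :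
    Tr quadrant (4 * n) (zRow x y n) (zCol x (y + 1) n) := by
  obtain ⟨T, hT, hg, hall⟩ := exists_tr_line (A := zRow x y n) (B := zRow x y n) (c := (x, y))
    (d := (0, 1)) (by simp [IsDir])
    (fun u hu => mem_quadrant.2 (by have := mem_zRow.1 hu; omega))
    (fun a b b' h1 h2 => by
      simp only [mem_zRow, frame, Toward] at h1 h2 ⊢
      omega)
    (fun u h => by simp only [mem_zRow, frame] at h; omega)
    subset_rfl (zRow_conn x y hn) (mem_zRow.2 (by simp only; omega))
    (fun a ha => mem_quadrant.2 (by simp only [frame]; omega))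
  have hcard := hT.card_eq
  rw [card_zRow] at hT hcard
  have hg' : (x, y + 1) ∈ T := by simpa [frame] using hg
  have := hT.conn_right.eq_zCol hg' fun u hu => by
    obtain ⟨a, ha, rfl⟩ := hall u hu
    simp only [frame]; omega
  rw [hcard] at this
  rw [← this]
  exact hT.mono (by omega)

/-- A connected shape in a rectangle becomes the vertical line with lower end `(a, b)`; the cost
is the area of the rectangle, plus a multiple of the order and of the distance to be covered. -/
theorem tr_zCol_of_subset {A : Finset Pt} (hA : Conn A) {x₁ x₂ y₁ y₂ a b : ℤ} {L K : ℕ}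
    (hAB : A ⊆ Finset.Icc x₁ x₂ ×ˢ Finset.Icc y₁ y₂) (hx₁ : 0 ≤ x₁) (hy₁ : 0 ≤ y₁)
    (hxL : x₂ - x₁ + 1 ≤ L) (hyL : y₂ - y₁ + 1 ≤ L) (ha : 0 ≤ a) (hb : 0 ≤ b)
    (hxK : x₂ + 1 ≤ a + K ∧ a ≤ x₁ + 1 + K) (hyK : y₂ + 1 ≤ b + K ∧ b ≤ y₁ + 1 + K) :
    Tr quadrant (L * L + 7 * A.card + 2 * K) A (zCol a b A.card) := by
  obtain ⟨c, hcA, hmax⟩ := Finset.exists_max_image A (fun u => u.1) hA.1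
  have hc := hAB hcA
  have hn := Finset.card_pos.2 hA.1
  simp only [Finset.mem_product, Finset.mem_Icc] at hc
  obtain ⟨T, hT, hg, hall⟩ := exists_tr_line (A := A)
    (B := Finset.Icc x₁ c.1 ×ˢ Finset.Icc y₁ y₂) (c := c) (d := (1, 0)) (by simp [IsDir])
    (fun u hu => mem_quadrant.2 (by
      simp only [Finset.mem_product, Finset.mem_Icc] at hu; omega))
    (fun p q q' h1 h2 => by
      simp only [Finset.mem_product, Finset.mem_Icc, frame, Toward] at h1 h2 ⊢
      omega)
    (fun u h => by simp only [Finset.mem_product, Finset.mem_Icc, frame] at h; omega)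
    (fun u hu => by
      have h1 := hAB hu
      have h2 := hmax u hu
      simp only [Finset.mem_product, Finset.mem_Icc] at h1 h2 ⊢
      omega) hA hcA
    (fun p hp => mem_quadrant.2 (by simp only [frame]; omega))
  have hcard := hT.card_eq
  have hg' : (c.1 + 1, c.2) ∈ T := by simpa [frame] using hg
  have := hT.conn_right.eq_zRow hg' fun u hu => by
    obtain ⟨p, hp, rfl⟩ := hall u hu
    simp only [frame]; omega
  rw [hcard] at this
  subst this
  have hB : (Finset.Icc x₁ c.1 ×ˢ Finset.Icc y₁ y₂).card ≤ L * L := by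
    rw [Finset.card_product, Int.card_Icc, Int.card_Icc]
    exact Nat.mul_le_mul (by omega) (by omega)
  refine (((hT.trans (tr_zRow hn (x' := a) (by omega) ha (by omega))).trans
    (tr_zRow_zCol hn ha (by omega))).trans
    (tr_zCol hn (y' := b) ha (by omega) hb)).mono ?_
  omega

/-- Every connected shape of order `n` in an `n × n` box is transformed into the vertical line of
order `n` at the corner of the box by `O(n √n)` moves. The boxes used on the way have a side of
about `√n`, so that there are `O(√n)` pieces, each of which is absorbed by `O(n)` moves. -/
theorem exists_tr_zCol {S : Finset Pt} (hS : Conn S) {a b : ℤ} (ha : 0 ≤ a) (hb : 0 ≤ b)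
    (hSa : ∀ u ∈ S, (a ≤ u.1 ∧ u.1 < a + S.card) ∧ b ≤ u.2 ∧ u.2 < b + S.card) :
    ∃ t : ℕ, Tr quadrant t S (zCol a b S.card) ∧
      (t : ℝ) ≤ 400 * (S.card * √(S.card : ℝ)) := by
  set n := S.card with hn
  have hn1 : 1 ≤ n := Finset.card_pos.2 hS.1
  set M : ℕ := ⌈√(n : ℝ)⌉₊ + 1 with hM
  set r : ℝ := √(n : ℝ) with hr
  have hnr : (1 : ℝ) ≤ n := by exact_mod_cast hn1
  have hrr : r * r = n := Real.mul_self_sqrt (by positivity)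
  have hr1 : 1 ≤ r := Real.one_le_sqrt.2 hnr
  have hM1 : r ≤ (M : ℝ) - 1 := by rw [hM]; push_cast; linarith [Nat.le_ceil r]
  have hM2 : (M : ℝ) ≤ 3 * r := by
    have := (Nat.ceil_lt_add_one (by linarith : (0 : ℝ) ≤ r)).le
    rw [hM]; push_cast; linarith
  have hcap : (n : ℤ) ≤ ((M : ℤ) - 1) * M := by
    have : (n : ℝ) ≤ ((M : ℝ) - 1) * M := by nlinarith
    exact_mod_cast this
  obtain ⟨o, ho, hoM, hoS⟩ := exists_offset (M := M) (by omega) S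
  obtain ⟨k, hk, hB⟩ := exists_built o M hS
  have hSW : ∀ u ∈ S, u ∈ quadrant := fun u hu => mem_quadrant.2 (by have := hSa u hu; omega)
  obtain ⟨T, hT, hTc, i, ⟨s, hs, rfl⟩, hTs⟩ := hB.collapse ho hoM hSW hcap
  have hTB : T ⊆ boxOf o M s := fun u hu =>
    (mem_boxOf ho hoM).2 ⟨hT.subset_right u hu, hTs u hu⟩
  have hsS := hSa s hs
  have h1 := cut_self ho hoM (show 0 ≤ s.1 by omega)
  have h2 := cut_self ho hoM (show 0 ≤ s.2 by omega)
  have h3 := cut_length ho hoM s.1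
  have h4 := cut_length ho hoM s.2
  have hcut : ∀ x : ℤ, 0 ≤ cutLo o M x := by
    intro x
    have h0 : 0 ≤ cutIdx o M x := le_max_left _ _
    unfold cutLo
    split_ifs
    · exact le_rfl
    · positivity
  have hT' := tr_zCol_of_subset hTc (L := 2 * M) (K := n + 2 * M) hTB (hcut _) (hcut _)
    (by push_cast; omega) (by push_cast; omega) ha hb (by push_cast; omega) (by push_cast; omega)
  have hcard := hT.card_eq
  rw [hcard] at hT'
  refine ⟨_, hT.trans hT', ?_⟩
  have hkM : (M : ℝ) * k ≤ 4 * n := by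
    have : M * k ≤ 4 * n := (Nat.mul_le_mul_left M hk).trans hoS
    exact_mod_cast this
  have hk0 : (0 : ℝ) ≤ k := by positivity
  have hkr : (k : ℝ) ≤ 4 * r := by
    have h5 : r * k ≤ r * (4 * r) := by nlinarith
    exact le_of_mul_le_mul_left h5 (by linarith)
  have hMM : (M : ℝ) * M ≤ 9 * n := by nlinarith
  have hrn : r ≤ n := by nlinarith
  have hnn : (n : ℝ) ≤ n * r := by nlinarith
  have hmain : (k : ℝ) * (8 * M * M + 6 * n) ≤ 312 * (n * r) := by
    calc (k : ℝ) * (8 * M * M + 6 * n) ≤ 4 * r * (78 * n) :=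
          mul_le_mul hkr (by nlinarith) (by positivity) (by linarith)
      _ = 312 * (n * r) := by ring
  rw [← hn]
  push_cast
  nlinarith

/-! ### Shapes in the quadrant -/

/-- A cell, viewed as a cell of the full grid. -/
def cellEmb : Cell ↪ Pt :=
  ⟨fun p => (p.1, p.2), fun p q h => by
    have := Prod.mk.inj h
    exact Prod.ext (by omega) (by omega)⟩

/-- A shape, viewed on the full grid. -/
def lift (S : Shape) : Finset Pt := S.map cellEmb

/-- The shape formed by the cells of `U` that lie in the quadrant. -/
noncomputable def lower (U : Finset Pt) : Shape := U.preimage cellEmb cellEmb.injective.injOn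

theorem mem_lift {S : Shape} {p : Cell} : ((p.1 : ℤ), (p.2 : ℤ)) ∈ lift S ↔ p ∈ S :=
  Finset.mem_map' cellEmb

theorem mem_lower {U : Finset Pt} {p : Cell} : p ∈ lower U ↔ ((p.1 : ℤ), (p.2 : ℤ)) ∈ U :=
  Finset.mem_preimage

theorem lower_lift (S : Shape) : lower (lift S) = S := by
  ext p; rw [mem_lower, mem_lift]

theorem card_lift (S : Shape) : (lift S).card = S.card := Finset.card_map _

theorem exists_of_mem_lift {S : Shape} {u : Pt} (h : u ∈ lift S) :
    ∃ p ∈ S, u = ((p.1 : ℤ), (p.2 : ℤ)) := by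
  obtain ⟨p, hp, rfl⟩ := Finset.mem_map.1 h
  exact ⟨p, hp, rfl⟩

theorem mem_hLine {x y k : ℕ} {p : Cell} : p ∈ hLine x y k ↔ (x ≤ p.1 ∧ p.1 < x + k) ∧ p.2 = y := by
  simp only [hLine, Finset.mem_image, Finset.mem_range]
  constructor
  · rintro ⟨i, hi, rfl⟩; dsimp only; omega
  · rintro ⟨h, rfl⟩; exact ⟨p.1 - x, by omega, Prod.ext (by simp only; omega) rfl⟩

theorem mem_vLine {x y k : ℕ} {p : Cell} : p ∈ vLine x y k ↔ p.1 = x ∧ y ≤ p.2 ∧ p.2 < y + k := by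
  simp only [vLine, Finset.mem_image, Finset.mem_range]
  constructor
  · rintro ⟨i, hi, rfl⟩; dsimp only; omega
  · rintro ⟨rfl, h⟩; exact ⟨p.2 - y, by omega, Prod.ext rfl (by simp only; omega)⟩

theorem mem_squareBox {a b s : ℕ} {p : Cell} :
    p ∈ squareBox a b s ↔ (a ≤ p.1 ∧ p.1 < a + s) ∧ b ≤ p.2 ∧ p.2 < b + s := by
  simp only [squareBox, Finset.mem_product, Finset.mem_Ico]

theorem conn_lift {S : Shape} (h : S.IsConnected) : Conn (lift S) := by
  have key : ∀ x y : {u : Cell // u ∈ S}, (Shape.graph S).Walk x y →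
      Link (lift S) (cellEmb x.1) (cellEmb y.1) := by
    intro x y walk
    induction walk with
    | nil => exact Relation.ReflTransGen.refl
    | @cons a b c hab _ ih =>
      refine Relation.ReflTransGen.head
        ⟨Finset.mem_map_of_mem _ a.2, Finset.mem_map_of_mem _ b.2, ?_⟩ ih
      obtain ⟨_, h1, h2, h3, h4⟩ := hab
      change Near ((a.1.1 : ℤ), (a.1.2 : ℤ)) ((b.1.1 : ℤ), (b.1.2 : ℤ))
      simp only [Near]
      omega
  obtain ⟨w, hw⟩ := h.nonempty
  refine Conn.of_center (w := cellEmb w) (Finset.mem_map_of_mem _ hw) fun u hu => ?_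
  obtain ⟨p, hp, rfl⟩ := Finset.mem_map.1 hu
  obtain ⟨walk⟩ := h.preconnected ⟨w, hw⟩ ⟨p, hp⟩
  exact key _ _ walk

theorem isConnected_lower {U : Finset Pt} (h : Conn U) (hW : ∀ u ∈ U, u ∈ quadrant) :
    (lower U).IsConnected := by
  have toNat : ∀ u ∈ U, ∃ p : Cell, u = ((p.1 : ℤ), (p.2 : ℤ)) := fun u hu => by
    have := mem_quadrant.1 (hW u hu)
    exact ⟨(u.1.toNat, u.2.toNat), Prod.ext (by simp only; omega) (by simp only; omega)⟩
  have key : ∀ u v, Link U u v → ∀ p q : Cell, ∀ hp : p ∈ lower U, ∀ hq : q ∈ lower U,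
      u = ((p.1 : ℤ), (p.2 : ℤ)) → v = ((q.1 : ℤ), (q.2 : ℤ)) →
      (Shape.graph (lower U)).Reachable ⟨p, hp⟩ ⟨q, hq⟩ := by
    intro u v h
    induction h with
    | refl =>
      intro p q hp hq h1 h2
      rw [h1] at h2
      obtain rfl : p = q := cellEmb.injective h2
      exact SimpleGraph.Reachable.refl _
    | @tail b c _ hbc ih =>
      intro p q hp hq h1 h2
      obtain ⟨e, rfl⟩ := toNat b hbc.1
      have he : e ∈ lower U := mem_lower.2 hbc.1
      refine (ih p e hp he h1 rfl).trans ?_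
      by_cases heq : e = q
      · subst heq; exact SimpleGraph.Reachable.refl _
      · refine SimpleGraph.Adj.reachable ⟨heq, ?_⟩
        have := hbc.2.2
        subst h2
        simp only [Near] at this
        dsimp only
        omega
  obtain ⟨w, hw⟩ := h.1
  obtain ⟨p, rfl⟩ := toNat w hw
  have : Nonempty {u : Cell // u ∈ lower U} := ⟨⟨p, mem_lower.2 hw⟩⟩
  exact ⟨fun x y => key _ _ (h.2 _ (mem_lower.1 x.2) _ (mem_lower.1 y.2)) x.1 y.1 x.2 y.2 rfl rfl⟩

theorem lineMove_lower {U V : Finset Pt} (h : Mv U V) (hU : ∀ u ∈ U, u ∈ quadrant)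
    (hV : ∀ u ∈ V, u ∈ quadrant) : LineMove (lower U) (lower V) := by
  rcases h with ⟨x, x', y, hne, hr, hn, rfl⟩ | ⟨x, y, y', hne, hr, hn, rfl⟩
  · have h1 := mem_quadrant.1 (hU _ (hr x (by omega)))
    have h2 := mem_quadrant.1 (hV _ (Finset.mem_insert_self _ _))
    simp only at h1 h2
    lift x to ℕ using h1.1
    lift y to ℕ using h1.2
    lift x' to ℕ using h2.1
    have hmem : ∀ a b : ℕ, ((a : ℤ), (b : ℤ)) ∈ insert ((x' : ℤ), (y : ℤ)) (U.erase (↑x, ↑y)) ↔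
        (a = x' ∧ b = y) ∨ ¬ (a = x ∧ b = y) ∧ ((a : ℤ), (b : ℤ)) ∈ U := fun a b => by
      simp only [Finset.mem_insert, Finset.mem_erase, ne_eq, Prod.mk.injEq, Nat.cast_inj]
    have hr' : ∀ i : ℕ, (x ≤ i ∧ i < x') ∨ (x' < i ∧ i ≤ x) → ((i : ℤ), (y : ℤ)) ∈ U :=
      fun i hi => hr i (by omega)
    rcases lt_or_gt_of_ne hne with h | h
    · refine LineMove.right x y (x' - x) (by omega) (fun p hp => ?_) ?_ ?_
      · obtain ⟨h3, h4⟩ := mem_hLine.1 hp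
        rw [mem_lower, h4]
        exact hr' _ (by omega)
      · rw [mem_lower, show x + (x' - x) = x' by omega]; exact hn
      · ext ⟨a, b⟩
        rw [mem_lower, hmem]
        simp only [Finset.mem_union, Finset.mem_sdiff, mem_hLine, mem_lower]
        by_cases hb : b = y
        · subst hb
          by_cases hab : ((a : ℤ), (b : ℤ)) ∈ U
          · simp only [hab, and_true, true_and]; omega
          · have := mt (hr' a) hab
            simp only [hab, and_true, and_false, false_and, or_false, false_or]; omega
        · simp [hb]
    · refine LineMove.left x' y (x - x') (by omega) (fun p hp => ?_) ?_ ?_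
      · obtain ⟨h3, h4⟩ := mem_hLine.1 hp
        rw [mem_lower, h4]
        exact hr' _ (by omega)
      · rw [mem_lower]; exact hn
      · ext ⟨a, b⟩
        rw [mem_lower, hmem]
        simp only [Finset.mem_union, Finset.mem_sdiff, mem_hLine, mem_lower]
        by_cases hb : b = y
        · subst hb
          by_cases hab : ((a : ℤ), (b : ℤ)) ∈ U
          · simp only [hab, and_true, true_and]; omega
          · have := mt (hr' a) hab
            simp only [hab, and_true, and_false, false_and, or_false, false_or]; omega
        · simp [hb]
  · have h1 := mem_quadrant.1 (hU _ (hr y (by omega)))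
    have h2 := mem_quadrant.1 (hV _ (Finset.mem_insert_self _ _))
    simp only at h1 h2
    lift x to ℕ using h1.1
    lift y to ℕ using h1.2
    lift y' to ℕ using h2.2
    have hmem : ∀ a b : ℕ, ((a : ℤ), (b : ℤ)) ∈ insert ((x : ℤ), (y' : ℤ)) (U.erase (↑x, ↑y)) ↔
        (a = x ∧ b = y') ∨ ¬ (a = x ∧ b = y) ∧ ((a : ℤ), (b : ℤ)) ∈ U := fun a b => by
      simp only [Finset.mem_insert, Finset.mem_erase, ne_eq, Prod.mk.injEq, Nat.cast_inj]
    have hr' : ∀ i : ℕ, (y ≤ i ∧ i < y') ∨ (y' < i ∧ i ≤ y) → ((x : ℤ), (i : ℤ)) ∈ U :=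
      fun i hi => hr i (by omega)
    rcases lt_or_gt_of_ne hne with h | h
    · refine LineMove.up x y (y' - y) (by omega) (fun p hp => ?_) ?_ ?_
      · obtain ⟨h3, h4⟩ := mem_vLine.1 hp
        rw [mem_lower, h3]
        exact hr' _ (by omega)
      · rw [mem_lower, show y + (y' - y) = y' by omega]; exact hn
      · ext ⟨a, b⟩
        rw [mem_lower, hmem]
        simp only [Finset.mem_union, Finset.mem_sdiff, mem_vLine, mem_lower]
        by_cases hb : a = x
        · subst hb
          by_cases hab : ((a : ℤ), (b : ℤ)) ∈ U
          · simp only [hab, and_true, true_and]; omega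
          · have := mt (hr' b) hab
            simp only [hab, true_and, and_false, false_and, or_false, false_or]; omega
        · simp [hb]
    · refine LineMove.down x y' (y - y') (by omega) (fun p hp => ?_) ?_ ?_
      · obtain ⟨h3, h4⟩ := mem_vLine.1 hp
        rw [mem_lower, h3]
        exact hr' _ (by omega)
      · rw [mem_lower]; exact hn
      · ext ⟨a, b⟩
        rw [mem_lower, hmem]
        simp only [Finset.mem_union, Finset.mem_sdiff, mem_vLine, mem_lower]
        by_cases hb : a = x
        · subst hb
          by_cases hab : ((a : ℤ), (b : ℤ)) ∈ U
          · simp only [hab, and_true, true_and]; omega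
          · have := mt (hr' b) hab
            simp only [hab, true_and, and_false, false_and, or_false, false_or]; omega
        · simp [hb]

theorem IsConnectedTransformation.append {f g : ℕ → Shape} {t t' : ℕ} {S S' S'' : Shape}
    (hf : IsConnectedTransformation f t S S') (hg : IsConnectedTransformation g t' S' S'') :
    ∃ h : ℕ → Shape, IsConnectedTransformation h (t + t') S S'' ∧ (∀ i ≤ t, h i = f i) ∧
      ∀ i, h (t + i) = g i := by
  obtain ⟨hf0, hft, hfm, hfc⟩ := hf
  obtain ⟨hg0, hgt, hgm, hgc⟩ := hg
  have h1 : ∀ i ≤ t, (fun i => if i ≤ t then f i else g (i - t)) i = f i := fun i hi => by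
    simp only [if_pos hi]
  have h2 : ∀ i, (fun i => if i ≤ t then f i else g (i - t)) (t + i) = g i := fun i => by
    rcases Nat.eq_zero_or_pos i with rfl | hi
    · simp [hft, hg0]
    · simp only [if_neg (show ¬ t + i ≤ t by omega), Nat.add_sub_cancel_left]
  refine ⟨fun i => if i ≤ t then f i else g (i - t), ⟨?_, ?_, fun i hi => ?_, fun i hi => ?_⟩,
    h1, h2⟩
  · rw [h1 0 (Nat.zero_le _), hf0]
  · rw [h2, hgt]
  · by_cases h : i < t
    · rw [h1 i h.le, h1 (i + 1) h]; exact hfm i h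
    · obtain ⟨j, rfl⟩ := Nat.exists_eq_add_of_le (not_lt.1 h)
      rw [h2, add_assoc, h2]; exact hgm j (by omega)
  · by_cases h : i ≤ t
    · rw [h1 i h]; exact hfc i h
    · obtain ⟨j, rfl⟩ := Nat.exists_eq_add_of_le (not_le.1 h).le
      rw [h2]; exact hgc j (by omega)

theorem Tr.exists_transformation {t : ℕ} {U V : Finset Pt} (h : Tr quadrant t U V) :
    ∃ t' ≤ t, ∃ f, IsConnectedTransformation f t' (lower U) (lower V) := by
  induction h with
  | @refl t U hc hW =>
    exact ⟨0, Nat.zero_le _, fun _ => lower U, rfl, rfl, fun i hi => absurd hi (Nat.not_lt_zero _),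
      fun i _ => isConnected_lower hc hW⟩
  | @tail t U V V' h hm hc hW ih =>
    obtain ⟨t', ht', f, hf⟩ := ih
    have hg : IsConnectedTransformation (fun i => if i = 0 then lower V else lower V') 1
        (lower V) (lower V') := by
      refine ⟨rfl, rfl, fun i hi => ?_, fun i hi => ?_⟩
      · obtain rfl : i = 0 := by omega
        exact lineMove_lower hm h.subset_right hW
      · obtain rfl | rfl : i = 0 ∨ i = 1 := by omega
        · exact isConnected_lower h.conn_right h.subset_right
        · exact isConnected_lower hc hW
    obtain ⟨k, hk, -⟩ := hf.append hg
    exact ⟨t' + 1, by omega, k, hk⟩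

/-! ### The square and the line -/

/-- The first `n` cells of the square box with corner `(a, b)` and side `s`, column by column. -/
def fillSquare (a b s n : ℕ) : Shape := (Finset.range n).image fun i => (a + i / s, b + i % s)

theorem mem_fillSquare {a b s n : ℕ} (hs : 0 < s) {p : Cell} : p ∈ fillSquare a b s n ↔
    a ≤ p.1 ∧ b ≤ p.2 ∧ p.2 < b + s ∧ (p.1 - a) * s + (p.2 - b) < n := by
  simp only [fillSquare, Finset.mem_image, Finset.mem_range]
  constructor
  · rintro ⟨i, hi, rfl⟩
    have h1 := Nat.mod_lt i hs
    have h2 := Nat.div_add_mod i s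
    simp only [Nat.add_sub_cancel_left]
    rw [mul_comm s] at h2
    exact ⟨Nat.le_add_right _ _, Nat.le_add_right _ _, by omega, by omega⟩
  · rintro ⟨h1, h2, h3, h4⟩
    refine ⟨_, h4, Prod.ext ?_ ?_⟩
    · rw [mul_comm, Nat.mul_add_div hs, Nat.div_eq_of_lt (by omega)]; simp only; omega
    · rw [mul_comm, Nat.mul_add_mod, Nat.mod_eq_of_lt (by omega)]; simp only; omega

theorem card_fillSquare (a b s n : ℕ) : (fillSquare a b s n).card = n := by
  rw [fillSquare, Finset.card_image_of_injective, Finset.card_range]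
  intro i j h
  obtain ⟨h1, h2⟩ := Prod.mk.inj h
  rw [← Nat.div_add_mod i s, ← Nat.div_add_mod j s, show i / s = j / s by omega,
    show i % s = j % s by omega]

theorem fillSquare_subset {a b s n : ℕ} (hs : 0 < s) (hn : n ≤ s * s) :
    fillSquare a b s n ⊆ squareBox a b s := by
  intro p hp
  obtain ⟨h1, h2, h3, h4⟩ := (mem_fillSquare hs).1 hp
  have : p.1 - a < s := by
    by_contra h
    have := Nat.mul_le_mul_right s (not_lt.1 h)
    omega
  exact mem_squareBox.2 (by omega)

theorem fillSquare_down {a b s n : ℕ} (hs : 0 < s) {p q : Cell} (hp : p ∈ fillSquare a b s n)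
    (h1 : a ≤ q.1) (h2 : q.1 ≤ p.1) (h3 : b ≤ q.2) (h4 : q.2 ≤ p.2) :
    q ∈ fillSquare a b s n := by
  rw [mem_fillSquare hs] at hp ⊢
  have := Nat.mul_le_mul_right s (show q.1 - a ≤ p.1 - a by omega)
  omega

theorem fillSquare_isNice {a b s n : ℕ} (hs : 0 < s) (hn : 1 ≤ n) :
    (fillSquare a b s n).IsNice := by
  obtain ⟨c, hc, hmax⟩ := Finset.exists_max_image (fillSquare a b s n) (fun u => u.1)
    (Finset.card_pos.1 (by rw [card_fillSquare]; omega))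
  have hc' := (mem_fillSquare hs).1 hc
  refine Or.inl ⟨a, b, c.1 - a + 1, by omega, fun p hp => ?_, fun u hu => ⟨?_, fun e he => ?_⟩⟩
  · have := mem_hLine.1 hp
    exact fillSquare_down hs hc (by omega) (by omega) (by omega) (by omega)
  · have h1 := hmax u hu
    have h2 := (mem_fillSquare hs).1 hu
    exact mem_hLine.2 (by dsimp only; omega)
  · have h2 := (mem_fillSquare hs).1 hu
    unfold Between at he
    exact fillSquare_down hs hu h2.1 le_rfl (by simp only; omega) (by simp only; omega)

theorem conn_lift_fillSquare {a b s n : ℕ} (hs : 0 < s) (hn : 1 ≤ n) :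
    Conn (lift (fillSquare a b s n)) := by
  have h0 : (a, b) ∈ fillSquare a b s n := (mem_fillSquare hs).2 (by simp; omega)
  refine Conn.of_center (w := ((a : ℤ), (b : ℤ))) (mem_lift (p := (a, b)).2 h0) fun u hu => ?_
  obtain ⟨⟨x, y⟩, hp, rfl⟩ := exists_of_mem_lift hu
  have hp' := (mem_fillSquare hs).1 hp
  simp only at hp'
  refine (link_row_of_le (x' := (x : ℤ)) (by omega) fun i h1 h2 => ?_).trans
    (link_col_of_le (by omega) fun i h1 h2 => ?_)
  · lift i to ℕ using by omega
    exact mem_lift (p := (i, b)).2 (fillSquare_down hs hp (by simp only; omega) (by simp only; omega)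
      le_rfl (by simp only; omega))
  · lift i to ℕ using by omega
    exact mem_lift (p := (x, i)).2 (fillSquare_down hs hp (by simp only; omega) le_rfl
      (by simp only; omega) (by simp only; omega))

theorem lower_zCol (a b n : ℕ) : lower (zCol a b n) = vLine a b n := by
  ext p
  rw [mem_lower, mem_zCol, mem_vLine]
  simp only
  omega

theorem subSide_bounds {n : ℕ} (hn : 1 ≤ n) :
    0 < subSide n ∧ n ≤ subSide n * subSide n ∧ subSide n * subSide n ≤ 4 * n := by
  have hnr : (1 : ℝ) ≤ n := by exact_mod_cast hn
  have hr1 : 1 ≤ √(n : ℝ) := Real.one_le_sqrt.2 hnr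
  have hrr : √(n : ℝ) * √(n : ℝ) = n := Real.mul_self_sqrt (by positivity)
  have h1 : √(n : ℝ) ≤ subSide n := Nat.le_ceil _
  have h2 : (subSide n : ℝ) < √(n : ℝ) + 1 := Nat.ceil_lt_add_one (by positivity)
  refine ⟨Nat.ceil_pos.2 (by linarith), ?_, ?_⟩
  · have : (n : ℝ) ≤ subSide n * subSide n := by nlinarith
    exact_mod_cast this
  · have : (subSide n : ℝ) * subSide n ≤ 4 * n := by nlinarith
    exact_mod_cast this

theorem tr_fillSquare (a b : ℕ) {n : ℕ} (hn : 1 ≤ n) :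
    Tr quadrant (21 * n) (lift (fillSquare a b (subSide n) n)) (zCol a b n) := by
  obtain ⟨hs0, hs1, hs2⟩ := subSide_bounds hn
  set s := subSide n
  have hcard : (lift (fillSquare a b s n)).card = n := by rw [card_lift, card_fillSquare]
  have := tr_zCol_of_subset (conn_lift_fillSquare (a := a) (b := b) hs0 hn) (x₁ := a)
    (x₂ := a + s - 1) (y₁ := b) (y₂ := b + s - 1) (a := a) (b := b) (L := s) (K := s)
    (fun u hu => by
      obtain ⟨p, hp, rfl⟩ := exists_of_mem_lift hu
      have := mem_squareBox.1 (fillSquare_subset hs0 hs1 hp)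
      simp only [Finset.mem_product, Finset.mem_Icc]
      omega) (by omega) (by omega) (by omega) (by omega) (by omega) (by omega) (by omega) (by omega)
  rw [hcard] at this
  exact this.mono (by nlinarith)

theorem isCompressedSquare_fillSquare {S : Shape} (hn : 1 ≤ S.card) {a b : ℕ}
    (hS : S ⊆ squareBox a b S.card) :
    IsCompressedSquare S (fillSquare a b (subSide S.card) S.card) := by
  obtain ⟨hs0, hs1, -⟩ := subSide_bounds hn
  refine ⟨card_fillSquare _ _ _ _, fillSquare_isNice hs0 hn, a, b, 0, 0, hS, hs0, hs0, ?_⟩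
  simpa using fillSquare_subset hs0 hs1

theorem exists_tr_lift {S : Shape} (hS : S.IsConnected) {a b : ℕ}
    (hSa : S ⊆ squareBox a b S.card) : ∃ t : ℕ, Tr quadrant t (lift S) (zCol a b S.card) ∧
      (t : ℝ) ≤ 400 * (S.card * √(S.card : ℝ)) := by
  have := exists_tr_zCol (conn_lift hS) (a := a) (b := b) (by omega) (by omega) (fun u hu => by
    obtain ⟨p, hp, rfl⟩ := exists_of_mem_lift hu
    have := mem_squareBox.1 (hSa hp)
    rw [card_lift]
    simp only
    omega)
  rwa [card_lift] at this

/-- Two connected shapes of the same order `n` in a common `n × n` box are transformed into each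
other by way of a compressed square, a line and a compressed square. -/
theorem exists_ucBoxTransforms {S S' : Shape} (hS : S.IsConnected) (hS' : S'.IsConnected)
    (hcard : S'.card = S.card) {a b : ℕ} (hSa : S ⊆ squareBox a b S.card)
    (hSa' : S' ⊆ squareBox a b S.card) :
    ∃ t : ℕ, (t : ℝ) ≤ 1000 * (S.card * √(S.card : ℝ)) ∧ UCBoxTransforms 1000 t S S' := by
  have hn : 1 ≤ S.card := by
    rw [← card_lift]; exact Finset.card_pos.2 (conn_lift hS).1
  obtain ⟨u, hu, hu'⟩ := exists_tr_lift hS hSa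
  obtain ⟨v, hv, hv'⟩ := exists_tr_lift hS' (by rwa [hcard])
  rw [hcard] at hv hv'
  have hq := tr_fillSquare a b hn
  obtain ⟨t₁, ht₁, f₁, hf₁⟩ := (hu.trans hq.symm).exists_transformation
  obtain ⟨t₂, ht₂, f₂, hf₂⟩ := hq.exists_transformation
  obtain ⟨t₃, ht₃, f₃, hf₃⟩ := hq.symm.exists_transformation
  obtain ⟨t₄, ht₄, f₄, hf₄⟩ := (hq.trans hv.symm).exists_transformation
  rw [lower_lift, lower_lift] at hf₁ hf₄
  rw [lower_lift, lower_zCol] at hf₂ hf₃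
  obtain ⟨g, hg, hg1, hg2⟩ := hf₁.append hf₂
  obtain ⟨g', hg', hg1', hg2'⟩ := hg.append hf₃
  obtain ⟨h, hh, hh1, hh2⟩ := hg'.append hf₄
  have hr : (1 : ℝ) ≤ √(S.card : ℝ) := Real.one_le_sqrt.2 (by exact_mod_cast hn)
  have hnr : (S.card : ℝ) ≤ S.card * √(S.card : ℝ) :=
    le_mul_of_one_le_right (by positivity) hr
  have hcast : ∀ {i j : ℕ}, i ≤ j → (i : ℝ) ≤ j := fun h => by exact_mod_cast h
  have h1 := hcast ht₁
  have h2 := hcast ht₂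
  have h3 := hcast ht₃
  have h4 := hcast ht₄
  push_cast at h1 h2 h3 h4
  have hn0 : (0 : ℝ) ≤ S.card := by positivity
  refine ⟨_, ?_, h, t₁, t₁ + t₂, t₁ + t₂ + t₃, hh, by omega, by omega, by omega, ?_, ?_, ?_, ?_, ?_⟩
  · push_cast
    linarith
  · rw [hh1 _ (by omega), hg1' _ (by omega), hg1 _ le_rfl, hf₁.2.1]
    exact isCompressedSquare_fillSquare hn hSa
  · rw [hh1 _ (by omega), hg1' _ le_rfl, hg.2.1]
    exact ⟨a, b, S.card, hn, Or.inr rfl⟩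
  · rw [hh1 _ le_rfl, hg'.2.1, ← hcard]
    exact isCompressedSquare_fillSquare (by omega) (by rwa [hcard])
  · rw [Nat.add_sub_cancel_left]; linarith
  · rw [Nat.add_sub_cancel_left]; linarith

/-! ### Translates and the common box -/

theorem exists_subset_squareBox {S : Shape} (hS : S.IsConnected) :
    ∃ a b, S ⊆ squareBox a b S.card ∧ ∀ p ∈ S, a ≤ p.1 ∧ b ≤ p.2 := by
  have hc := conn_lift hS
  obtain ⟨w⟩ := hS.nonempty
  obtain ⟨u, hu, hu'⟩ := Finset.exists_min_image S (fun p => p.1) ⟨w.1, w.2⟩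
  obtain ⟨v, hv, hv'⟩ := Finset.exists_min_image S (fun p => p.2) ⟨w.1, w.2⟩
  refine ⟨u.1, v.2, fun p hp => mem_squareBox.2 ?_, fun p hp => ⟨hu' p hp, hv' p hp⟩⟩
  have h1 := hc.fst_extent (mem_lift.2 hu) (mem_lift.2 hp)
  have h2 := hc.snd_extent (mem_lift.2 hv) (mem_lift.2 hp)
  have h3 := hu' p hp
  have h4 := hv' p hp
  rw [card_lift] at h1 h2
  simp only at h1 h2
  omega

/-- A connected shape has a connected translate with any prescribed lower left corner. -/
theorem exists_translate {S : Shape} (hS : S.IsConnected) (a b : ℕ) :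
    ∃ S' : Shape, IsTranslate S S' ∧ S'.IsConnected ∧ S'.card = S.card ∧
      S' ⊆ squareBox a b S.card := by
  obtain ⟨c, d, hbox, hmin⟩ := exists_subset_squareBox hS
  have hinj : Set.InjOn (fun p : Cell => (p.1 - c + a, p.2 - d + b)) S := by
    intro p hp q hq h
    have h1 := hmin p hp
    have h2 := hmin q hq
    have := Prod.mk.inj h
    exact Prod.ext (by omega) (by omega)
  have hcell : ∀ p ∈ S, (p.1 - c + a, p.2 - d + b) + (c, d) = p + (a, b) := by
    intro p hp
    have := hmin p hp
    refine Prod.ext ?_ ?_ <;> simp only [Prod.fst_add, Prod.snd_add] <;> omega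
  refine ⟨S.image fun p => (p.1 - c + a, p.2 - d + b), ⟨(a, b), (c, d), ?_⟩, ?_,
    Finset.card_image_of_injOn hinj, ?_⟩
  · rw [Finset.image_image]
    exact Finset.image_congr fun p hp => (hcell p hp).symm
  · have himage : lower ((lift S).map
        (frameEquiv (a - c, b - d) (1, 0) (Or.inl rfl)).toEmbedding) =
        S.image fun p => (p.1 - c + a, p.2 - d + b) := by
      ext q
      rw [mem_lower, Finset.mem_image, Finset.mem_map]
      constructor
      · rintro ⟨u, hu, h⟩
        obtain ⟨p, hp, rfl⟩ := exists_of_mem_lift hu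
        have h1 := hmin p hp
        simp only [Equiv.coe_toEmbedding, frameEquiv, Equiv.coe_fn_mk, frame, Prod.mk.injEq] at h
        exact ⟨p, hp, Prod.ext (by simp only; omega) (by simp only; omega)⟩
      · rintro ⟨p, hp, rfl⟩
        have h1 := hmin p hp
        exact ⟨_, mem_lift.2 hp, Prod.ext (by simp [frameEquiv, frame]; omega)
          (by simp [frameEquiv, frame]; omega)⟩
    rw [← himage]
    refine isConnected_lower ((conn_lift hS).map_of_near (frameEquiv_isRigid _ _ _).near)
      fun u hu => ?_
    · obtain ⟨v, hv, rfl⟩ := Finset.mem_map.1 hu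
      obtain ⟨p, hp, rfl⟩ := exists_of_mem_lift hv
      have h1 := hmin p hp
      rw [mem_quadrant]
      simp only [Equiv.coe_toEmbedding, frameEquiv, Equiv.coe_fn_mk, frame]
      omega
  · intro q hq
    obtain ⟨p, hp, rfl⟩ := Finset.mem_image.1 hq
    have := mem_squareBox.1 (hbox hp)
    exact mem_squareBox.2 (by simp only; omega)

theorem mainTheorem2 :
    ∃ C : ℝ, ∀ (n : ℕ) (S_I S_F : Shape),
      S_I.IsConnected → S_F.IsConnected → S_I.card = n → S_F.card = n →
        ∃ S : Shape, IsTranslate S_F S ∧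
          ((∃ a b : ℕ, S_I ⊆ squareBox a b n ∧ S_F ⊆ squareBox a b n) → S = S_F) ∧
          (∃ t : ℕ, (t : ℝ) ≤ C * (n * √(n : ℝ)) ∧ UCBoxTransforms C t S_I S) ∧
          (∃ t : ℕ, (t : ℝ) ≤ C * (n * √(n : ℝ)) ∧ UCBoxTransforms C t S S_I) := by
  refine ⟨1000, fun n S_I S_F hI hF hIn hFn => ?_⟩
  have both : ∀ S : Shape, S.IsConnected → S.card = n → ∀ a b, S_I ⊆ squareBox a b n →
      S ⊆ squareBox a b n →
      (∃ t : ℕ, (t : ℝ) ≤ 1000 * (n * √(n : ℝ)) ∧ UCBoxTransforms 1000 t S_I S) ∧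
      (∃ t : ℕ, (t : ℝ) ≤ 1000 * (n * √(n : ℝ)) ∧ UCBoxTransforms 1000 t S S_I) := by
    intro S hS hSn a b h1 h2
    have h3 := exists_ucBoxTransforms hI hS (by omega) (a := a) (b := b) (by rwa [hIn])
      (by rwa [hIn])
    have h4 := exists_ucBoxTransforms hS hI (by omega) (a := a) (b := b) (by rwa [hSn])
      (by rwa [hSn])
    rw [hIn] at h3
    rw [hSn] at h4
    exact ⟨h3, h4⟩
  by_cases h : ∃ a b : ℕ, S_I ⊆ squareBox a b n ∧ S_F ⊆ squareBox a b n
  · obtain ⟨a, b, h1, h2⟩ := h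
    exact ⟨S_F, ⟨0, 0, rfl⟩, fun _ => rfl, both S_F hF hFn a b h1 h2⟩
  · obtain ⟨a, b, h1, -⟩ := exists_subset_squareBox hI
    obtain ⟨S, hT, hS, hSn, h2⟩ := exists_translate hF a b
    exact ⟨S, hT, fun h' => absurd h' h,
      both S hS (by omega) a b (by rwa [hIn] at h1) (by rwa [hFn] at h2)⟩
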